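/- For a probability distribution $q$ over $[n]=\{1,\dots,n\}$ and $x\ge 0$, let $q_{-x}$ be the vector obtained from $q$ by iteratively removing (setting to $0$) its smallest entries, stopping just before the total removed mass exceeds $x$. Let $\|v\|_0$ be the number of nonzero entries of $v$ and $\|v\|_r=(\sum_i|v_i|^r)^{1/r}$ for $r>0$. For $0\le\varepsilon_1<\varepsilon_2$ and $\delta>0$ let $\mathrm{SC}(q,\varepsilon_1,\varepsilon_2,\delta)$ be the minimum (infimum) of the $m\ge 0$ for which some randomized tester, given $N\sim\mathrm{Poi}(m)$ i.i.d. samples from an unknown distribution $p$ over $[n]$ (Poissonized sampling model), distinguishes $\|p-q\|_1\le\varepsilon_1$ from $\|p-q\|_1\ge\varepsilon_2$ with probability at least $1-\delta$. Theorem (instance-optimal tolerant identity testing lower bound). There is a universal constant $c>0$ such that for every $n$, every distribution $q$ over $[n]$ and all $0\le\varepsilon_1<\varepsilon_2<c/4$, \[ \mathrm{SC}(q,\varepsilon_1,\varepsilon_2,1/5)\;\ge\;\tilde\Omega\!\left(\|q_{-4\varepsilon_2/c}\|_0\,\frac{\varepsilon_1}{\varepsilon_2^2}+\|q_{-4\varepsilon_2/c}\|_{1/2}\Big(\frac{\varepsilon_1}{\varepsilon_2^2}\Big)^2+\frac{\|q_{-4\varepsilon_2/c}\|_{2/3}}{\varepsilon_2^2}\right)-O\!\left(\frac{1}{\varepsilon_2^2}\right),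 \] where $\tilde\Omega$ hides polylogarithmic factors in $n$ and in its argument. That is, there are universal constants $c,A,C>0$ and $k\in\mathbb N$ such that, with $F$ denoting the argument of $\tilde\Omega$ above, \[ \mathrm{SC}(q,\varepsilon_1,\varepsilon_2,1/5)\;\ge\;\frac{A\,F}{\big((1+\log n)(1+\log(1+F))\big)^k}-\frac{C}{\varepsilon_2^2}. \] -/

import Mathlib

open scoped BigOperators NNReal ENNReal

noncomputable section

namespace TolerantTesting

/-- The `ℓ₁` distance between two vectors indexed by `[n]`. -/
def l1Dist {n : ℕ} (p q : Fin n → ℝ) : ℝ := ∑ i, |p i - q i|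

/-- The `0`-quasinorm: the number of nonzero entries. -/
def l0Norm {n : ℕ} (v : Fin n → ℝ) : ℝ := ((Finset.univ.filter fun i => v i ≠ 0).card : ℝ)

/-- The `r`-quasinorm `(∑ |v i| ^ r) ^ (1 / r)`, for `r > 0`. -/
def lrNorm (r : ℝ) {n : ℕ} (v : Fin n → ℝ) : ℝ := (∑ i, |v i| ^ r) ^ (1 / r)

/-- The indices that come no later than `i` when the entries of `q` are listed in
nondecreasing order, ties being broken by the index. -/
def upTo {n : ℕ} (q : Fin n → ℝ) (i : Fin n) : Finset (Fin n) :=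
  Finset.univ.filter fun j => q j < q i ∨ (q j = q i ∧ j ≤ i)

/-- The vector `q_{-x}`: the entries of `q` are removed (set to `0`) one after the other, the
smallest first, stopping just before the total removed mass exceeds `x`. -/
def removeSmallest {n : ℕ} (q : Fin n → ℝ) (x : ℝ) : Fin n → ℝ :=
  fun i => if ∑ j ∈ upTo q i, q j ≤ x then 0 else q i

/-- A (randomized) tester for distributions over `[n]`: for every finite sequence of samples,
the probability, over its internal randomness, that it answers "close". -/
structure Tester (n : ℕ) where
  acceptProb : (N : ℕ) → (Fin N → Fin n) → ℝ
  acceptProb_mem : ∀ (N : ℕ) (x : Fin N → Fin n), acceptProb N x ∈ Set.Icc (0 : ℝ) 1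

/-- The probability that the tester answers "close" in the Poissonized sampling model: it is given
`N` i.i.d. samples from `p`, where `N` is Poisson with mean `m`. -/
def Tester.probClose {n : ℕ} (T : Tester n) (p : Fin n → ℝ) (m : ℝ≥0) : ℝ :=
  ∫ N : ℕ, (∑ x : Fin N → Fin n, (∏ j, p (x j)) * T.acceptProb N x)
    ∂(ProbabilityTheory.poissonMeasure m)

/-- With `Poi(m)` samples from an unknown distribution `p` over `[n]`, the tester is correct with
probability at least `1 - δ` in telling `‖p - q‖₁ ≤ ε₁` from `‖p - q‖₁ ≥ ε₂`. -/
def Tester.Distinguishes {n : ℕ} (T : Tester n) (q : Fin n → ℝ) (ε₁ ε₂ δ : ℝ) (m : ℝ≥0) : Prop :=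
  ∀ p ∈ stdSimplex ℝ (Fin n),
    (l1Dist p q ≤ ε₁ → 1 - δ ≤ T.probClose p m) ∧
    (ε₂ ≤ l1Dist p q → 1 - δ ≤ 1 - T.probClose p m)

/-- The Poissonized sample complexity of tolerant identity testing with reference distribution `q`:
the least `m` for which some tester succeeds with probability at least `1 - δ` from `Poi(m)`
samples (it is `⊤` if there is no such `m`). -/
def sampleComplexity {n : ℕ} (q : Fin n → ℝ) (ε₁ ε₂ δ : ℝ) : ℝ≥0∞ :=
  ⨅ (m : ℝ≥0) (_ : ∃ T : Tester n, T.Distinguishes q ε₁ ε₂ δ m), (m : ℝ≥0∞)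

/-- The quantity `‖v‖₀ (ε₁/ε₂²) + ‖v‖_{1/2} (ε₁/ε₂²)² + ‖v‖_{2/3}/ε₂²`. -/
def instanceCost {n : ℕ} (v : Fin n → ℝ) (ε₁ ε₂ : ℝ) : ℝ :=
  l0Norm v * (ε₁ / ε₂ ^ 2) + lrNorm (1 / 2) v * (ε₁ / ε₂ ^ 2) ^ 2 + lrNorm (2 / 3) v / ε₂ ^ 2

end TolerantTesting

end

noncomputable section

namespace TolerantTesting

open Finset

/-! The proof is a two-prior (Le Cam) argument. In decreasing order of mass, every other index
belongs to a set `M`, whose coordinates receive independent perturbations `δ i * y`. The heavier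
partners outside `M` form a reservoir of mass at least `1/2`, rescaled by `drain` to restore total
mass one. The total perturbation fluctuates by much less than `1 / √m`, so the rescaling can be
frozen at its mean almost unnoticed by the tester (`abs_poissonAccept_drain_sub_le`). The counts of
the symbols are then independent, and the priors are compared by the χ² bound
`sq_sum_mul_poissonAccept_le`.

For the two terms involving `ε₁`, `y` follows one of two laws with `L + 2` common moments, where `L`
is of order `log n`. Under the first, the mean of `|y|` is a small multiple of `ε₁ / ε₂`; under the
second, `|y| ≥ 1` (`exists_matching_moments`). So the first prior is mostly close and the second
far. Exchanging the laws in one coordinate costs at most `3 / 10 ^ (L + 2)`, which is affordable for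
`n ≤ 10 ^ L` coordinates. For the last term, `q` itself is compared with random signs `± δ i`, whose
χ² distance is governed by `∑ (m δ² / q)²`.

Profiles `δ` proportional to `q ^ r`, truncated at `q`, with `r = 0, 1/2, 2/3`, give the three
terms. They are normalised by a sum over the entries kept in `q_{-x}`. Truncation does no harm: once
a kept entry is truncated, so are all lighter ones, and those in `M` already carry mass at least
`ε₂` (`exists_truncated_profile`). Powers of `L` become the polylogarithmic loss, and the heaviest,
unpaired index costs `O(1 / ε₂ ^ 2)`. -/

/-! ### Poissonized acceptance probabilities and the χ² bound -/

/-- The probability that the tester answers "close" when, for each `i`, it receives an independent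
`Poi(m p i)` number of copies of `i`, in random order; `p` need not have total mass one. -/
def poissonAccept {n : ℕ} (T : Tester n) (m : ℝ) (p : Fin n → ℝ) : ℝ :=
  ∑' N : ℕ, Real.exp (-(m * ∑ i, p i)) * (m ^ N / N.factorial) *
    ∑ x : Fin N → Fin n, (∏ j, p (x j)) * T.acceptProb N x

lemma probClose_eq_poissonAccept {n : ℕ} (T : Tester n) (m : ℝ≥0) {p : Fin n → ℝ}
    (hp : p ∈ stdSimplex ℝ (Fin n)) : T.probClose p m = poissonAccept T m p := by
  unfold Tester.probClose poissonAccept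
  rw [ProbabilityTheory.integral_poissonMeasure]
  simp [hp.2, mul_div_assoc]

lemma hasSum_exp_mul (m w : ℝ) :
    HasSum (fun N : ℕ => m ^ N / N.factorial * w ^ N) (Real.exp (m * w)) := by
  have := NormedSpace.expSeries_div_hasSum_exp (m * w)
  rw [← Real.exp_eq_exp_ℝ] at this
  refine this.congr_fun fun N => ?_
  rw [mul_pow]; ring

lemma sum_prod_mul_acceptProb_nonneg {n : ℕ} (T : Tester n) {p : Fin n → ℝ} (hp : ∀ i, 0 ≤ p i)
    (N : ℕ) : 0 ≤ ∑ x : Fin N → Fin n, (∏ j, p (x j)) * T.acceptProb N x :=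
  sum_nonneg fun x _ => mul_nonneg (prod_nonneg fun _ _ => hp _) (T.acceptProb_mem N x).1

lemma sum_prod_mul_acceptProb_le {n : ℕ} (T : Tester n) {p : Fin n → ℝ} (hp : ∀ i, 0 ≤ p i)
    (N : ℕ) : ∑ x : Fin N → Fin n, (∏ j, p (x j)) * T.acceptProb N x ≤ (∑ i, p i) ^ N := by
  rw [Fintype.sum_pow]
  exact sum_le_sum fun x _ => mul_le_of_le_one_right (prod_nonneg fun _ _ => hp _)
    (T.acceptProb_mem N x).2

lemma hasSum_poisson_weights (m w : ℝ) :
    HasSum (fun N : ℕ => Real.exp (-(m * w)) * (m ^ N / N.factorial) * w ^ N) 1 := by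
  have := (hasSum_exp_mul m w).mul_left (Real.exp (-(m * w)))
  rw [← Real.exp_add, neg_add_cancel, Real.exp_zero] at this
  simpa only [mul_assoc] using this

lemma summable_poissonAccept {n : ℕ} (T : Tester n) {m : ℝ} (hm : 0 ≤ m) {p : Fin n → ℝ}
    (hp : ∀ i, 0 ≤ p i) :
    Summable fun N : ℕ => Real.exp (-(m * ∑ i, p i)) * (m ^ N / N.factorial) *
      ∑ x : Fin N → Fin n, (∏ j, p (x j)) * T.acceptProb N x :=
  (hasSum_poisson_weights m (∑ i, p i)).summable.of_nonneg_of_le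
    (fun N => mul_nonneg (by positivity) (sum_prod_mul_acceptProb_nonneg T hp N))
    (fun N => mul_le_mul_of_nonneg_left (sum_prod_mul_acceptProb_le T hp N) (by positivity))

lemma poissonAccept_nonneg {n : ℕ} (T : Tester n) {m : ℝ} (hm : 0 ≤ m) {p : Fin n → ℝ}
    (hp : ∀ i, 0 ≤ p i) : 0 ≤ poissonAccept T m p :=
  tsum_nonneg fun N => mul_nonneg (by positivity) (sum_prod_mul_acceptProb_nonneg T hp N)

lemma poissonAccept_le_one {n : ℕ} (T : Tester n) {m : ℝ} (hm : 0 ≤ m) {p : Fin n → ℝ}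
    (hp : ∀ i, 0 ≤ p i) : poissonAccept T m p ≤ 1 := by
  rw [← (hasSum_poisson_weights m (∑ i, p i)).tsum_eq]
  exact (summable_poissonAccept T hm hp).tsum_le_tsum
    (fun N => mul_le_mul_of_nonneg_left (sum_prod_mul_acceptProb_le T hp N) (by positivity))
    (hasSum_poisson_weights m (∑ i, p i)).summable

/-- Cauchy–Schwarz against the product weights `∏ j, b (x j)`, whose total is `(∑ i, b i) ^ N`.
Where a weight vanishes `d` has to vanish too, because division by zero drops that term. -/
lemma sq_sum_mul_le_sum_sq_div_mul {n N : ℕ} (d : (Fin N → Fin n) → ℝ) {b : Fin n → ℝ}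
    (hb : ∀ i, 0 ≤ b i) (hd : ∀ x, ∏ j, b (x j) = 0 → d x = 0) {t : (Fin N → Fin n) → ℝ}
    (ht : ∀ x, t x ∈ Set.Icc (0 : ℝ) 1) :
    (∑ x, d x * t x) ^ 2 ≤ (∑ x, d x ^ 2 / ∏ j, b (x j)) * (∑ i, b i) ^ N := by
  rw [Fintype.sum_pow b]
  have hB : ∀ x : Fin N → Fin n, 0 ≤ ∏ j, b (x j) := fun x => prod_nonneg fun _ _ => hb _
  refine sum_sq_le_sum_mul_sum_of_sq_le_mul _ (fun x _ => div_nonneg (sq_nonneg _) (hB x))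
    (fun x _ => hB x) (fun x _ => ?_)
  by_cases h : ∏ j, b (x j) = 0
  · simp [hd x h]
  · rw [div_mul_cancel₀ _ h, mul_pow]
    exact mul_le_of_le_one_right (sq_nonneg _) (pow_le_one₀ (ht x).1 (ht x).2)

/-- The second moment method for Poissonized sampling: the `χ²` distance, with base `b`, of two
mixtures bounds the difference of their acceptance probabilities. -/
lemma sq_sum_mul_poissonAccept_le {n : ℕ} {α : Type*} [Fintype α] (T : Tester n) {m : ℝ}
    (hm : 0 ≤ m) (σ : α → ℝ) (p : α → Fin n → ℝ) {b : Fin n → ℝ} (hp : ∀ a i, 0 ≤ p a i)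
    (hb : ∀ i, 0 ≤ b i) (hbp : ∀ a i, b i = 0 → p a i = 0) :
    (∑ a, σ a * poissonAccept T m (p a)) ^ 2 ≤
      ∑ a, ∑ a', σ a * σ a' * Real.exp (m * ∑ i, (p a i - b i) * (p a' i - b i) / b i) := by
  -- Absorbing the factor `exp (-m ∑ p)` into the signed weights leaves coefficients `c N` common to
  -- all `a`.
  set E : α → ℝ := fun a => σ a * Real.exp (-(m * ∑ i, p a i)) with hE
  set c : ℕ → ℝ := fun N => m ^ N / N.factorial with hc
  have hc0 : ∀ N, 0 ≤ c N := fun N => by positivity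
  set d : (N : ℕ) → (Fin N → Fin n) → ℝ := fun N x => ∑ a, E a * ∏ j, p a (x j) with hd
  set Q : ℕ → ℝ := fun N => ∑ x, d N x ^ 2 / ∏ j, b (x j) with hQ
  have hQ0 : ∀ N, 0 ≤ Q N := fun N => sum_nonneg fun x _ =>
    div_nonneg (sq_nonneg _) (prod_nonneg fun _ _ => hb _)
  have hQeq : ∀ N, Q N = ∑ a, ∑ a', E a * E a' * (∑ i, p a i * p a' i / b i) ^ N := by
    intro N
    simp_rw [Fintype.sum_pow, hQ, hd, sq, sum_mul_sum, sum_div]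
    rw [sum_comm]
    refine sum_congr rfl fun a _ => ?_
    rw [sum_comm]
    refine sum_congr rfl fun a' _ => ?_
    rw [mul_sum]
    refine sum_congr rfl fun x _ => ?_
    rw [prod_div_distrib, prod_mul_distrib]; ring
  have hsumQ : HasSum (fun N => c N * Q N)
      (∑ a, ∑ a', E a * E a' * Real.exp (m * ∑ i, p a i * p a' i / b i)) := by
    have := hasSum_sum (s := univ) fun a _ => hasSum_sum (s := univ) fun a' _ =>
      (hasSum_exp_mul m (∑ i, p a i * p a' i / b i)).mul_left (E a * E a')
    refine this.congr_fun fun N => ?_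
    rw [hQeq, mul_sum]
    refine sum_congr rfl fun a _ => ?_
    rw [mul_sum]
    exact sum_congr rfl fun a' _ => mul_left_comm _ _ _
  have hsumW := hasSum_exp_mul m (∑ i, b i)
  have hsumT : HasSum (fun N => c N * ∑ x, d N x * T.acceptProb N x)
      (∑ a, σ a * poissonAccept T m (p a)) := by
    have := hasSum_sum (s := univ) fun a _ =>
      ((summable_poissonAccept T hm (hp a)).hasSum.mul_left (σ a))
    refine this.congr_fun fun N => ?_
    simp only [hd, sum_mul, hE, hc]
    rw [sum_comm, mul_sum]
    refine sum_congr rfl fun a _ => ?_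
    simp only [mul_sum]
    refine sum_congr rfl fun x _ => ?_
    ring
  -- Cauchy–Schwarz over `N` is applied to finite partial sums; the limit is taken afterwards.
  have key : ∀ s : Finset ℕ, (∑ N ∈ s, c N * ∑ x, d N x * T.acceptProb N x) ^ 2 ≤
      (∑ a, ∑ a', E a * E a' * Real.exp (m * ∑ i, p a i * p a' i / b i)) *
        Real.exp (m * ∑ i, b i) := by
    intro s
    have h1 : (∑ N ∈ s, c N * ∑ x, d N x * T.acceptProb N x) ^ 2 ≤
        (∑ N ∈ s, c N * Q N) * ∑ N ∈ s, c N * (∑ i, b i) ^ N := by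
      refine sum_sq_le_sum_mul_sum_of_sq_le_mul _ (fun N _ => mul_nonneg (hc0 N) (hQ0 N))
        (fun N _ => mul_nonneg (hc0 N) (pow_nonneg (sum_nonneg fun i _ => hb i) _))
        (fun N _ => ?_)
      have := sq_sum_mul_le_sum_sq_div_mul (d N) hb (fun x hx => by
        obtain ⟨j, -, hj⟩ := prod_eq_zero_iff.1 hx
        exact sum_eq_zero fun a _ => by
          rw [prod_eq_zero (mem_univ j) (hbp a _ hj), mul_zero]) (T.acceptProb_mem N)
      calc _ = c N ^ 2 * (∑ x, d N x * T.acceptProb N x) ^ 2 := by ring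
        _ ≤ c N ^ 2 * (Q N * (∑ i, b i) ^ N) := by gcongr
        _ = _ := by ring
    refine h1.trans (mul_le_mul ?_ ?_ ?_ ?_)
    · exact sum_le_hasSum s (fun N _ => mul_nonneg (hc0 N) (hQ0 N)) hsumQ
    · exact sum_le_hasSum s (fun N _ =>
        mul_nonneg (hc0 N) (pow_nonneg (sum_nonneg fun i _ => hb i) _)) hsumW
    · exact sum_nonneg fun N _ =>
        mul_nonneg (hc0 N) (pow_nonneg (sum_nonneg fun i _ => hb i) _)
    · exact hsumQ.nonneg fun N => mul_nonneg (hc0 N) (hQ0 N)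
  refine (le_of_tendsto (Filter.Tendsto.pow hsumT 2) (Filter.Eventually.of_forall key)).trans_eq ?_
  rw [sum_mul]
  refine sum_congr rfl fun a _ => ?_
  rw [sum_mul]
  refine sum_congr rfl fun a' _ => ?_
  have hx : ∑ i, (p a i - b i) * (p a' i - b i) / b i =
      ∑ i, p a i * p a' i / b i - ∑ i, p a i - ∑ i, p a' i + ∑ i, b i := by
    rw [← sum_sub_distrib, ← sum_sub_distrib, ← sum_add_distrib]
    refine sum_congr rfl fun i _ => ?_
    by_cases h : b i = 0
    · simp [h, hbp a i h, hbp a' i h]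
    · field_simp; ring
  have : m * ∑ i, (p a i - b i) * (p a' i - b i) / b i =
      -(m * ∑ i, p a i) + (-(m * ∑ i, p a' i) + (m * ∑ i, p a i * p a' i / b i +
        m * ∑ i, b i)) := by rw [hx]; ring
  rw [this, Real.exp_add, Real.exp_add, Real.exp_add]
  simp only [hE]
  ring

/-! ### Two laws with matching moments -/

/-- If a signed combination of points annihilates the first `K` powers, its exponential energy is
small. -/
lemma sum_sum_mul_exp_le_of_moments {κ : Type*} [Fintype κ] (σ Y : κ → ℝ) {K : ℕ} (hK : 0 < K)
    (hmom : ∀ j < K, ∑ k, σ k * Y k ^ j = 0) {t ρ : ℝ} (hρ : ρ ≤ 1)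
    (hY : ∀ k k', |t * (Y k * Y k')| ≤ ρ) :
    ∑ k, ∑ k', σ k * σ k' * Real.exp (t * (Y k * Y k')) ≤ (∑ k, |σ k|) ^ 2 * (2 * ρ ^ K) := by
  -- The Taylor polynomial of degree below `K` splits into products of vanishing moments, so only
  -- the remainder of the exponential counts.
  have h0 : ∑ k, ∑ k', σ k * σ k' * ∑ j ∈ range K, (t * (Y k * Y k')) ^ j / j.factorial = 0 := by
    simp_rw [mul_sum]
    have : ∀ k, ∑ k', ∑ j ∈ range K, σ k * σ k' * ((t * (Y k * Y k')) ^ j / j.factorial) = 0 := by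
      intro k
      rw [sum_comm]
      refine sum_eq_zero fun j hj => ?_
      have := hmom j (mem_range.1 hj)
      calc _ = (σ k * (t * Y k) ^ j / j.factorial) * ∑ k', σ k' * Y k' ^ j := by
            rw [mul_sum]
            refine sum_congr rfl fun k' _ => ?_
            rw [mul_pow, mul_pow, mul_pow]; ring
        _ = 0 := by rw [this, mul_zero]
    exact sum_eq_zero fun k _ => this k
  have hdiff : ∑ k, ∑ k', σ k * σ k' * Real.exp (t * (Y k * Y k')) =
      ∑ k, ∑ k', σ k * σ k' * (Real.exp (t * (Y k * Y k')) -
        ∑ j ∈ range K, (t * (Y k * Y k')) ^ j / j.factorial) := by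
    simp_rw [mul_sub, sum_sub_distrib]
    rw [h0, sub_zero]
  rw [hdiff, sq, sum_mul_sum, sum_mul]
  refine sum_le_sum fun k _ => ?_
  rw [sum_mul]
  refine sum_le_sum fun k' _ => ?_
  refine (le_abs_self _).trans ?_
  rw [abs_mul, abs_mul]
  refine mul_le_mul_of_nonneg_left ?_ (by positivity)
  have hb := Real.exp_bound ((hY k k').trans hρ) hK
  refine hb.trans ?_
  rw [mul_comm (2 : ℝ)]
  refine mul_le_mul (pow_le_pow_left₀ (abs_nonneg _) (hY k k') _) ?_ (by positivity)
    (pow_nonneg ((abs_nonneg _).trans (hY k k')) _)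
  rw [div_le_iff₀ (by positivity)]
  have h1 : (1 : ℝ) ≤ K.factorial := by exact_mod_cast Nat.factorial_pos K
  have h2 : (1 : ℝ) ≤ K := by exact_mod_cast hK
  push_cast
  nlinarith

/-- This is the `2L`-th forward difference at `0` of `(X - L) ^ (2r)`, a polynomial of degree below
`2L`. -/
lemma sum_alternating_choose_mul_pow_eq_zero {L r : ℕ} (hr : r < L) :
    ∑ i ∈ range (2 * L + 1), (-1 : ℝ) ^ i * (2 * L).choose i * (((i : ℝ) - L) ^ 2) ^ r = 0 := by
  have hdeg : ((Polynomial.X - Polynomial.C (L : ℝ)) ^ (2 * r)).natDegree < 2 * L := by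
    rw [Polynomial.natDegree_pow, Polynomial.natDegree_X_sub_C]; omega
  have h := congrFun (Polynomial.fwdDiff_iter_eq_zero_of_degree_lt hdeg) 0
  rw [fwdDiff_iter_eq_sum_shift] at h
  refine Eq.trans (sum_congr rfl fun i hi => ?_) h
  have hi' : i ≤ 2 * L := Nat.lt_succ_iff.1 (mem_range.1 hi)
  have hpow : (-1 : ℝ) ^ (2 * L - i) = (-1) ^ i := by
    have h1 : (-1 : ℝ) ^ (2 * L - i) * (-1) ^ i = 1 := by
      rw [← pow_add, Nat.sub_add_cancel hi', pow_mul]; simp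
    have h2 : (-1 : ℝ) ^ i * (-1) ^ i = 1 := by rw [← mul_pow]; simp
    exact mul_right_cancel₀ (pow_ne_zero i (by norm_num : (-1 : ℝ) ≠ 0)) (h1.trans h2.symm)
  simp [zsmul_eq_mul, hpow, pow_mul]

/-- Splitting a signed combination with vanishing moments into two probability vectors. -/
lemma exists_prob_of_signed {κ : Type*} [Fintype κ] (w y : κ → ℝ) {K : ℕ} (hK : 0 < K)
    (hmom : ∀ r < K, ∑ k, w k * y k ^ r = 0) {k₀ : κ} (hk₀ : w k₀ = 1) :
    ∃ u v : κ → ℝ, (∀ k, 0 ≤ u k) ∧ (∀ k, 0 ≤ v k) ∧ ∑ k, u k = 1 ∧ ∑ k, v k = 1 ∧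
      (∀ r < K, ∑ k, (u k - v k) * y k ^ r = 0) ∧
      (∀ k, u k ≤ max (w k) 0) ∧ (∀ k, v k ≤ max (-w k) 0) := by
  have hsum : ∑ k, max (w k) 0 = ∑ k, max (-w k) 0 := by
    have := hmom 0 hK
    simp only [pow_zero, mul_one] at this
    rw [← sub_eq_zero, ← sum_sub_distrib]
    refine Eq.trans (sum_congr rfl fun k _ => ?_) this
    rcases le_total (w k) 0 with h | h
    · rw [max_eq_right h, max_eq_left (by linarith)]; ring
    · rw [max_eq_left h, max_eq_right (by linarith)]; ring
  -- The positive and negative parts have the same mass `Z ≥ w k₀ = 1`, so normalising only shrinks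
  -- the weights.
  set Z := ∑ k, max (w k) 0 with hZ
  have hZ1 : 1 ≤ Z := by
    rw [← hk₀]
    exact (le_max_left _ _).trans (single_le_sum (f := fun k => max (w k) 0)
      (fun k _ => le_max_right _ _) (mem_univ k₀))
  have hZ0 : 0 < Z := by linarith
  refine ⟨fun k => max (w k) 0 / Z, fun k => max (-w k) 0 / Z, fun k => by positivity,
    fun k => by positivity, ?_, ?_, ?_, ?_, ?_⟩
  · rw [← sum_div, div_self hZ0.ne']
  · rw [← sum_div, ← hsum, div_self hZ0.ne']
  · intro r hr
    have : ∀ k, (max (w k) 0 / Z - max (-w k) 0 / Z) * y k ^ r = (w k * y k ^ r) / Z := by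
      intro k
      rcases le_total (w k) 0 with h | h
      · rw [max_eq_right h, max_eq_left (by linarith)]; ring
      · rw [max_eq_left h, max_eq_right (by linarith)]; ring
    simp_rw [this, ← sum_div, hmom r hr, zero_div]
  · exact fun k => div_le_self (le_max_right _ _) hZ1
  · exact fun k => div_le_self (le_max_right _ _) hZ1

/-- A signed combination of points with many vanishing moments: mass about `1` at the origin,
mass about `-1/2` at `1` and `-1` each, and masses of order `ϑ²` at points of order at least
`1 / ϑ`. -/
lemma exists_signed_moments_eq_zero {L : ℕ} (hL : 1 ≤ L) {ϑ : ℝ} (hϑ : 0 < ϑ)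
    (hϑL : 16 * L * ϑ ≤ 1) :
    ∃ (a z : Fin (2 * L + 1) → ℝ) (s t : ℝ) (i₀ : Fin (2 * L + 1)),
      (∀ r < L + 2, ∑ i, a i * z i ^ r + (s * 1 ^ r + t * (-1) ^ r) = 0) ∧
      a i₀ = 1 ∧ z i₀ = 0 ∧ (∀ i, i ≠ i₀ → 1 ≤ z i) ∧ (∀ i, 0 ≤ z i ∧ z i ≤ L ^ 2 / ϑ) ∧
      (∀ i, |a i| * z i ≤ 2 * ϑ) ∧ (∀ i, |a i| * z i ^ 2 ≤ 2) ∧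
      s ≤ 0 ∧ t ≤ 0 ∧ -(s + t) ≤ 3 / 2 := by
  have hL1 : (1 : ℝ) ≤ L := by exact_mod_cast hL
  have hϑ1 : ϑ ≤ 1 / 16 := by nlinarith
  have hcb : (0 : ℝ) < L.centralBinom := by exact_mod_cast Nat.centralBinom_pos L
  set c : ℕ → ℝ := fun i => (2 * L).choose i / L.centralBinom with hc
  have hc0 : ∀ i, 0 ≤ c i := fun i => by positivity
  have hc1 : ∀ i, c i ≤ 1 := fun i => by
    rw [div_le_one hcb]; exact_mod_cast Nat.choose_le_centralBinom i L
  -- Squares keep all these points nonnegative; in the end no point lies below `-1`, so that `δ ≤ q`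
  -- suffices for positivity.
  set x : Fin (2 * L + 1) → ℝ := fun i => (((i : ℕ) : ℝ) - L) ^ 2 with hx
  -- With `z = x / ϑ` the last factor is `1 / (1 - z²)`: it is `1` at the origin and of order `ϑ² /
  -- x²` elsewhere.
  set a : Fin (2 * L + 1) → ℝ := fun i => (-1) ^ ((i : ℕ) + L) * c i * (ϑ ^ 2 / (ϑ ^ 2 - x i ^ 2))
    with ha
  set i₀ : Fin (2 * L + 1) := ⟨L, by omega⟩ with hi₀
  have hx1 : ∀ i, i ≠ i₀ → 1 ≤ x i := by
    intro i hi
    have hne : (i : ℕ) ≠ L := fun h => hi (Fin.ext h)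
    have : (1 : ℤ) ≤ ((i : ℤ) - L) ^ 2 := by
      have : ((i : ℤ) - L) ≠ 0 := by omega
      have := sq_pos_of_ne_zero this
      omega
    simp only [hx]
    exact_mod_cast this
  have hx0 : x i₀ = 0 := by simp [hx, hi₀]
  have hxL : ∀ i, x i ≤ L ^ 2 := by
    intro i
    have h1 : ((i : ℕ) : ℝ) ≤ 2 * L := by exact_mod_cast Nat.lt_succ_iff.1 i.2
    have h2 : (0 : ℝ) ≤ ((i : ℕ) : ℝ) := Nat.cast_nonneg _
    simp only [hx]; nlinarith
  have ha0 : a i₀ = 1 := by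
    have hcL : c (i₀ : ℕ) = 1 := by
      simp only [hc, hi₀]
      rw [← Nat.centralBinom_eq_two_mul_choose, div_self hcb.ne']
    have hpow : (-1 : ℝ) ^ ((i₀ : ℕ) + L) = 1 := by
      simp only [hi₀]; rw [← two_mul, pow_mul]; simp
    simp only [ha]
    rw [hcL, hpow, hx0]; field_simp; simp
  have hne : ∀ i, ϑ ^ 2 - x i ^ 2 ≠ 0 := by
    intro i
    by_cases h : i = i₀
    · rw [h, hx0]; simpa using hϑ.ne'
    · have := hx1 i h
      nlinarith
  have habs : ∀ i, i ≠ i₀ → |a i| * x i ^ 2 ≤ 2 * ϑ ^ 2 := by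
    intro i hi
    have h1 := hx1 i hi
    have h2 : 0 < x i ^ 2 - ϑ ^ 2 := by nlinarith
    have h3 : |a i| ≤ ϑ ^ 2 / (x i ^ 2 - ϑ ^ 2) := by
      simp only [ha]
      rw [abs_mul, abs_mul, abs_pow, abs_neg, abs_one, one_pow, one_mul, abs_of_nonneg (hc0 _),
        abs_div, abs_of_nonneg (sq_nonneg ϑ), abs_sub_comm, abs_of_pos h2]
      exact mul_le_of_le_one_left (by positivity) (hc1 _)
    calc |a i| * x i ^ 2 ≤ ϑ ^ 2 / (x i ^ 2 - ϑ ^ 2) * x i ^ 2 := by gcongr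
      _ ≤ 2 * ϑ ^ 2 := by
        rw [div_mul_eq_mul_div, div_le_iff₀ h2]
        nlinarith [mul_nonneg (sq_nonneg ϑ) (by nlinarith : 0 ≤ x i ^ 2 - 2 * ϑ ^ 2)]
  have habs1 : ∀ i, |a i| * x i ≤ 2 * ϑ ^ 2 := by
    intro i
    by_cases h : i = i₀
    · rw [h, hx0]; simp; positivity
    · refine le_trans ?_ (habs i h)
      have := hx1 i h
      gcongr; nlinarith
  have hB : |∑ i, a i * x i| ≤ ϑ / 4 := by
    have hterm : ∀ i ∈ univ.erase i₀, |a i * x i| ≤ 2 * ϑ ^ 2 := fun i hi => by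
      rw [abs_mul, abs_of_nonneg (show 0 ≤ x i from sq_nonneg _)]; exact habs1 i
    rw [← add_sum_erase _ _ (mem_univ i₀), hx0]
    have := sum_le_card_nsmul _ _ _ hterm
    rw [card_erase_of_mem (mem_univ _), card_univ, Fintype.card_fin, nsmul_eq_mul,
      Nat.add_sub_cancel] at this
    rw [mul_zero, zero_add]
    refine (abs_sum_le_sum_abs _ _).trans (this.trans ?_)
    push_cast
    nlinarith
  have hA : |∑ i, a i - 1| ≤ 1 / 4 := by
    rw [← add_sum_erase _ _ (mem_univ i₀), ha0, add_sub_cancel_left]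
    refine (abs_sum_le_sum_abs _ _).trans ?_
    have hterm : ∀ i ∈ univ.erase i₀, |a i| ≤ 2 * ϑ ^ 2 := fun i hi => by
      refine le_trans ?_ (habs1 i)
      exact le_mul_of_one_le_right (abs_nonneg _) (hx1 i (ne_of_mem_erase hi))
    have := sum_le_card_nsmul _ _ _ hterm
    rw [card_erase_of_mem (mem_univ _), card_univ, Fintype.card_fin, nsmul_eq_mul,
      Nat.add_sub_cancel] at this
    refine this.trans ?_
    push_cast
    nlinarith
  set A := ∑ i, a i with hAdef
  set B := (∑ i, a i * x i) / ϑ with hBdef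
  have hB' : |B| ≤ 1 / 4 := by
    rw [hBdef, abs_div, abs_of_pos hϑ, div_le_iff₀ hϑ]; linarith
  have hAl := abs_le.1 hA
  have hBl := abs_le.1 hB'
  -- Multiplying by `z² - 1` cancels the denominator of `a` and leaves the alternating binomial sum,
  -- so moments depend only on the parity of their order.
  have hrec : ∀ r < L, ∑ i, a i * (x i / ϑ) ^ (r + 2) = ∑ i, a i * (x i / ϑ) ^ r := by
    intro r hr
    rw [← sub_eq_zero, ← sum_sub_distrib]
    have hfd := sum_alternating_choose_mul_pow_eq_zero hr
    rw [← Fin.sum_univ_eq_sum_range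
      (fun i => (-1 : ℝ) ^ i * (2 * L).choose i * (((i : ℝ) - L) ^ 2) ^ r)] at hfd
    calc _ = -((-1) ^ L / L.centralBinom / ϑ ^ r) * ∑ i : Fin (2 * L + 1), (-1 : ℝ) ^ (i : ℕ) *
          (2 * L).choose i * ((((i : ℕ) : ℝ) - L) ^ 2) ^ r := by
          rw [mul_sum]
          refine sum_congr rfl fun i _ => ?_
          have h1 : a i * (x i / ϑ) ^ (r + 2) - a i * (x i / ϑ) ^ r =
              -((-1) ^ ((i : ℕ) + L) * c i) * (x i / ϑ) ^ r := by
            have hD : ϑ ^ 2 / (ϑ ^ 2 - x i ^ 2) * ((x i / ϑ) ^ 2 - 1) = -1 := by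
              rw [div_mul_eq_mul_div, div_eq_iff (hne i)]
              field_simp
              ring
            simp only [ha]
            linear_combination ((-1) ^ ((i : ℕ) + L) * c i * (x i / ϑ) ^ r) * hD
          rw [h1, pow_add, div_pow]
          simp only [hc, hx]
          ring
      _ = 0 := by rw [hfd, mul_zero]
  -- Atoms at `±1` also have parity-periodic moments; these masses cancel the even moments `A` and
  -- the odd moments `B`. They are negative since `A` is near `1` and `B` near `0`.
  refine ⟨a, fun i => x i / ϑ, -(A + B) / 2, -(A - B) / 2, i₀, ?_, ha0, by simp [hx0], ?_, ?_, ?_,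
    ?_, by linarith, by linarith, by linarith⟩
  · intro r
    induction r using Nat.twoStepInduction with
    | zero => intro _; simp [← hAdef]; ring
    | one =>
      intro _
      have : ∑ i, a i * (x i / ϑ) ^ 1 = B := by
        rw [hBdef, sum_div]
        exact sum_congr rfl fun i _ => by ring
      rw [this]; ring
    | more r ih _ =>
      intro hr
      rw [hrec r (by omega), pow_add, pow_add]
      simpa using ih (by omega)
  · intro i hi
    rw [le_div_iff₀ hϑ]
    have := hx1 i hi
    linarith
  · exact fun i => ⟨div_nonneg (sq_nonneg _) hϑ.le, div_le_div_of_nonneg_right (hxL i) hϑ.le⟩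
  · intro i
    rw [← mul_div_assoc, div_le_iff₀ hϑ]
    have := habs1 i
    linarith
  · intro i
    by_cases h : i = i₀
    · simp [h, hx0]
    · rw [div_pow, ← mul_div_assoc, div_le_iff₀ (by positivity)]
      exact habs i h

/-- Two probability vectors on common points, with many common moments, of which one has small and
the other has large mean absolute value. -/
lemma exists_matching_moments {L : ℕ} (hL : 1 ≤ L) {ϑ : ℝ} (hϑ : 0 < ϑ) (hϑL : 16 * L * ϑ ≤ 1) :
    ∃ (κ : Type) (_ : Fintype κ) (y u v : κ → ℝ), (∀ k, 0 ≤ u k) ∧ (∀ k, 0 ≤ v k) ∧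
      ∑ k, u k = 1 ∧ ∑ k, v k = 1 ∧ (∀ r < L + 2, ∑ k, (u k - v k) * y k ^ r = 0) ∧
      (∀ k, -1 ≤ y k) ∧ (∀ k, y k ≤ L ^ 2 / ϑ) ∧ (∀ k, v k ≠ 0 → 1 ≤ |y k|) ∧
      ∑ k, u k * |y k| ≤ 6 * L * ϑ ∧ ∑ k, v k * |y k| ≤ 2 ∧
      ∑ k, u k * y k ^ 2 ≤ 8 * L ∧ ∑ k, v k * y k ^ 2 ≤ 8 * L := by
  obtain ⟨a, z, s, t, i₀, hmom, ha0, hz0, hz1, hz, haz, haz2, hs, ht, hst⟩ :=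
    exists_signed_moments_eq_zero hL hϑ hϑL
  have hL1 : (1 : ℝ) ≤ L := by exact_mod_cast hL
  have hϑ1 : ϑ ≤ 1 / 16 := by nlinarith
  set y : Fin (2 * L + 1) ⊕ Bool → ℝ := Sum.elim z (fun b => if b then 1 else -1) with hy
  set w : Fin (2 * L + 1) ⊕ Bool → ℝ := Sum.elim a (fun b => if b then s else t) with hw
  obtain ⟨u, v, hu0, hv0, hu1, hv1, huv, huw, hvw⟩ := exists_prob_of_signed w y (K := L + 2)
    (by omega) (fun r hr => by
      rw [Fintype.sum_sum_type, Fintype.sum_bool]; simpa [hw, hy] using hmom r hr)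
    (k₀ := Sum.inl i₀) (by simp [hw, ha0])
  -- Nonpositive signed mass at `±1` keeps `u` off these atoms, and positive mass at the origin
  -- keeps `v` off it. This separates the mean absolute values.
  have hut : u (Sum.inr true) = 0 := le_antisymm
    ((huw _).trans (by simp [hw, hs])) (hu0 _)
  have huf : u (Sum.inr false) = 0 := le_antisymm
    ((huw _).trans (by simp [hw, ht])) (hu0 _)
  have hvt : v (Sum.inr true) ≤ -s := (hvw _).trans (by simp [hw, hs])
  have hvf : v (Sum.inr false) ≤ -t := (hvw _).trans (by simp [hw, ht])
  have hui : ∀ i, u (Sum.inl i) ≤ |a i| := fun i =>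
    (huw _).trans (by simp [hw, le_abs_self])
  have hvi : ∀ i, v (Sum.inl i) ≤ |a i| := fun i =>
    (hvw _).trans (by simp [hw, neg_le_abs])
  have hsum1 : ∑ i, |a i| * z i ≤ 6 * L * ϑ := by
    have := sum_le_card_nsmul univ _ _ (fun i _ => haz i)
    rw [card_univ, Fintype.card_fin, nsmul_eq_mul] at this
    push_cast at this
    nlinarith
  have hsum2 : ∑ i, |a i| * z i ^ 2 ≤ 6 * L := by
    have := sum_le_card_nsmul univ _ _ (fun i _ => haz2 i)
    rw [card_univ, Fintype.card_fin, nsmul_eq_mul] at this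
    push_cast at this
    nlinarith
  have hLϑ : 1 ≤ (L : ℝ) ^ 2 / ϑ := by
    rw [le_div_iff₀ hϑ]; nlinarith
  refine ⟨_, inferInstance, y, u, v, hu0, hv0, hu1, hv1, huv, ?_, ?_, ?_, ?_, ?_, ?_, ?_⟩
  · rintro (i | b)
    · simp only [hy, Sum.elim_inl]; linarith [(hz i).1]
    · cases b <;> simp [hy]
  · rintro (i | b)
    · exact (hz i).2
    · cases b
      · simp only [hy, Sum.elim_inr, Bool.false_eq_true, if_false]; linarith
      · simpa [hy] using hLϑ
  · rintro (i | b) hvk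
    · have : i ≠ i₀ := by
        rintro rfl
        refine hvk (le_antisymm ((hvw _).trans ?_) (hv0 _))
        simp [hw, ha0]
      simp only [hy, Sum.elim_inl]
      exact (hz1 i this).trans (le_abs_self _)
    · cases b <;> simp [hy]
  · rw [Fintype.sum_sum_type, Fintype.sum_bool, hut, huf, zero_mul, zero_mul, add_zero, add_zero]
    refine le_trans (sum_le_sum fun i _ => ?_) hsum1
    simp only [hy, Sum.elim_inl, abs_of_nonneg (hz i).1]
    exact mul_le_mul_of_nonneg_right (hui i) (hz i).1
  · rw [Fintype.sum_sum_type, Fintype.sum_bool]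
    have : ∑ i, v (Sum.inl i) * |y (Sum.inl i)| ≤ 6 * L * ϑ := by
      refine le_trans (sum_le_sum fun i _ => ?_) hsum1
      simp only [hy, Sum.elim_inl, abs_of_nonneg (hz i).1]
      exact mul_le_mul_of_nonneg_right (hvi i) (hz i).1
    simp [hy] at this ⊢
    linarith
  · rw [Fintype.sum_sum_type, Fintype.sum_bool, hut, huf, zero_mul, zero_mul, add_zero, add_zero]
    have : ∑ i, u (Sum.inl i) * y (Sum.inl i) ^ 2 ≤ 6 * L :=
      le_trans (sum_le_sum fun i _ => mul_le_mul_of_nonneg_right (hui i) (sq_nonneg _)) hsum2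
    linarith
  · rw [Fintype.sum_sum_type, Fintype.sum_bool]
    have : ∑ i, v (Sum.inl i) * y (Sum.inl i) ^ 2 ≤ 6 * L :=
      le_trans (sum_le_sum fun i _ => mul_le_mul_of_nonneg_right (hvi i) (sq_nonneg _)) hsum2
    simp [hy] at this ⊢
    linarith

/-! ### Averages over independent coordinates -/

section ProductMean

variable {ι κ : Type*} [Fintype ι] [DecidableEq ι] [Fintype κ]

/-- The mean of `Ψ` when the coordinates are independent with weights `W i`. -/
def prodMean (W : ι → κ → ℝ) (Ψ : (ι → κ) → ℝ) : ℝ := ∑ f : ι → κ, (∏ i, W i (f i)) * Ψ f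

lemma sum_prod_weights {W : ι → κ → ℝ} (hW : ∀ i, ∑ k, W i k = 1) :
    ∑ f : ι → κ, ∏ i, W i (f i) = 1 := by
  rw [← Fintype.prod_sum]; simp [hW]

lemma prodMean_sub (W : ι → κ → ℝ) (Ψ Ψ' : (ι → κ) → ℝ) :
    prodMean W (fun f => Ψ f - Ψ' f) = prodMean W Ψ - prodMean W Ψ' := by
  simp [prodMean, mul_sub]

lemma prodMean_sum {γ : Type*} (s : Finset γ) (W : ι → κ → ℝ) (Ψ : γ → (ι → κ) → ℝ) :
    prodMean W (fun f => ∑ c ∈ s, Ψ c f) = ∑ c ∈ s, prodMean W (Ψ c) := by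
  simp only [prodMean, mul_sum]
  exact sum_comm

lemma prodMean_const {W : ι → κ → ℝ} (hW : ∀ i, ∑ k, W i k = 1) (c : ℝ) :
    prodMean W (fun _ => c) = c := by
  rw [prodMean, ← sum_mul, sum_prod_weights hW, one_mul]

lemma prodMean_mono {W : ι → κ → ℝ} (hW : ∀ i k, 0 ≤ W i k) {Ψ Ψ' : (ι → κ) → ℝ}
    (h : ∀ f, Ψ f ≤ Ψ' f) : prodMean W Ψ ≤ prodMean W Ψ' :=
  sum_le_sum fun f _ => mul_le_mul_of_nonneg_left (h f) (prod_nonneg fun i _ => hW i _)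

/-- Resampling one coordinate. -/
lemma prodMean_resample (i : ι) (W W' : ι → κ → ℝ) (hne : ∀ j, j ≠ i → W' j = W j)
    (hW' : ∑ k, W' i k = 1) (Ψ : (ι → κ) → ℝ) :
    prodMean W Ψ = prodMean W' (fun f => ∑ k, W i k * Ψ (Function.update f i k)) := by
  -- Exchanging coordinate `i` with an independent draw from `W' i` is an involution of the enlarged
  -- space.
  have hinv : Function.Involutive
      (fun x : (ι → κ) × κ => (Function.update x.1 i x.2, x.1 i)) := by
    rintro ⟨f, k⟩
    simp
  have hprod : ∀ (V : ι → κ → ℝ) (f : ι → κ),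
      ∏ j, V j (f j) = V i (f i) * ∏ j ∈ univ.erase i, V j (f j) := fun V f =>
    (mul_prod_erase _ _ (mem_univ i)).symm
  have h1 : prodMean W Ψ = ∑ x : (ι → κ) × κ, (∏ j, W j (x.1 j)) * W' i x.2 * Ψ x.1 := by
    rw [Fintype.sum_prod_type, prodMean]
    refine sum_congr rfl fun f _ => ?_
    dsimp only
    rw [← sum_mul, ← mul_sum, hW', mul_one]
  rw [h1, ← Equiv.sum_comp hinv.toPerm, Fintype.sum_prod_type, prodMean]
  refine sum_congr rfl fun f _ => ?_
  rw [mul_sum]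
  refine sum_congr rfl fun k _ => ?_
  simp only [Function.Involutive.coe_toPerm]
  rw [hprod W, hprod W' f, Function.update_self]
  have : ∏ j ∈ univ.erase i, W j (Function.update f i k j) =
      ∏ j ∈ univ.erase i, W' j (f j) := by
    refine prod_congr rfl fun j hj => ?_
    rw [Function.update_of_ne (ne_of_mem_erase hj), hne j (ne_of_mem_erase hj)]
  rw [this]; ring

/-- Changing the weights coordinate by coordinate. -/
lemma abs_prodMean_sub_le {u v : κ → ℝ} (hu : ∀ k, 0 ≤ u k) (hv : ∀ k, 0 ≤ v k)
    (hu1 : ∑ k, u k = 1) (hv1 : ∑ k, v k = 1) (Ψ : (ι → κ) → ℝ) {ε : ℝ}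
    (h : ∀ i f, |∑ k, (u k - v k) * Ψ (Function.update f i k)| ≤ ε) :
    |prodMean (fun _ : ι => u) Ψ - prodMean (fun _ : ι => v) Ψ| ≤ Fintype.card ι * ε := by
  -- Hybrids: weights `u` on `s` and `v` off it, with `s` growing one coordinate at a time.
  set W : Finset ι → ι → κ → ℝ := fun s i => if i ∈ s then u else v with hW
  have hW0 : ∀ s i k, 0 ≤ W s i k := fun s i k => by
    simp only [hW]; split_ifs <;> simp [hu, hv]
  have hW1 : ∀ s i, ∑ k, W s i k = 1 := fun s i => by
    simp only [hW]; split_ifs <;> assumption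
  have key : ∀ s : Finset ι, |prodMean (W s) Ψ - prodMean (W ∅) Ψ| ≤ s.card * ε := by
    intro s
    induction s using Finset.induction_on with
    | empty => simp
    | insert i s hi ih =>
      have hstep : |prodMean (W (insert i s)) Ψ - prodMean (W s) Ψ| ≤ ε := by
        have e1 := prodMean_resample i (W (insert i s)) (W s) (fun j hj => by simp [hW, hj])
          (hW1 s i) Ψ
        have e2 := prodMean_resample i (W s) (W s) (fun _ _ => rfl) (hW1 s i) Ψ
        rw [e1, e2, ← prodMean_sub]
        have hle : ∀ f : ι → κ, |∑ k, W (insert i s) i k * Ψ (Function.update f i k) -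
            ∑ k, W s i k * Ψ (Function.update f i k)| ≤ ε := by
          intro f
          rw [← sum_sub_distrib]
          simpa [hW, hi, sub_mul] using h i f
        rw [abs_le]
        constructor
        · rw [← prodMean_const (hW1 s) (-ε)]
          exact prodMean_mono (hW0 s) fun f => (abs_le.1 (hle f)).1
        · rw [← prodMean_const (hW1 s) ε]
          exact prodMean_mono (hW0 s) fun f => (abs_le.1 (hle f)).2
      rw [card_insert_of_notMem hi]
      push_cast
      have := abs_sub_le (prodMean (W (insert i s)) Ψ) (prodMean (W s) Ψ) (prodMean (W ∅) Ψ)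
      linarith
  simpa [hW] using key univ

lemma prodMean_coord {u : κ → ℝ} (hu1 : ∑ k, u k = 1) (i : ι) (g : κ → ℝ) :
    prodMean (fun _ : ι => u) (fun f => g (f i)) = ∑ k, u k * g k := by
  rw [prodMean_resample i _ (fun _ => u) (fun _ _ => rfl) hu1]
  simp only [Function.update_self]
  exact prodMean_const (fun _ => hu1) _

/-- Independent centred coordinates are orthogonal: resampling one with the other fixed kills each
cross term. -/
lemma prodMean_sq_sum {u : κ → ℝ} (hu1 : ∑ k, u k = 1) {g : κ → ℝ}
    (hg : ∑ k, u k * g k = 0) (d : ι → ℝ) :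
    prodMean (fun _ : ι => u) (fun f => (∑ i, d i * g (f i)) ^ 2) =
      (∑ i, d i ^ 2) * ∑ k, u k * g k ^ 2 := by
  have hsq : ∀ f : ι → κ, (∑ i, d i * g (f i)) ^ 2 =
      ∑ i, ∑ j, d i * g (f i) * (d j * g (f j)) := fun f => by rw [sq, sum_mul_sum]
  simp only [hsq]
  rw [prodMean_sum, sum_mul]
  refine sum_congr rfl fun i _ => ?_
  rw [prodMean_sum]
  rw [sum_eq_single i]
  · rw [prodMean_coord hu1 i (fun k => d i * g k * (d i * g k)), mul_sum]
    exact sum_congr rfl fun k _ => by ring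
  · intro j _ hj
    rw [prodMean_resample i _ (fun _ => u) (fun _ _ => rfl) hu1]
    simp only [Function.update_self, Function.update_of_ne hj]
    have : ∀ f : ι → κ, ∑ k, u k * (d i * g k * (d j * g (f j))) = 0 := by
      intro f
      calc _ = (d i * (d j * g (f j))) * ∑ k, u k * g k := by
            rw [mul_sum]; exact sum_congr rfl fun k _ => by ring
        _ = 0 := by rw [hg, mul_zero]
    simp only [this]
    exact prodMean_const (fun _ => hu1) 0
  · simp

end ProductMean

/-- Markov's inequality for finite sums. -/
lemma sum_filter_lt_le {α : Type*} [Fintype α] {π g : α → ℝ} (hπ : ∀ a, 0 ≤ π a)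
    (hg : ∀ a, 0 ≤ g a) {c p : ℝ} (hc : 0 ≤ c) (h : ∑ a, π a * g a ≤ c * p) (hp : 0 ≤ p) :
    ∑ a with c < g a, π a ≤ p := by
  rcases hc.eq_or_lt with rfl | hc
  · have h0 : ∑ a, π a * g a = 0 := le_antisymm (by simpa using h)
      (sum_nonneg fun a _ => mul_nonneg (hπ a) (hg a))
    rw [sum_eq_zero_iff_of_nonneg (fun a _ => mul_nonneg (hπ a) (hg a))] at h0
    refine le_trans (le_of_eq (sum_eq_zero fun a ha => ?_)) hp
    have := (mem_filter.1 ha).2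
    exact (mul_eq_zero.1 (h0 a (mem_univ a))).resolve_right this.ne'
  · have h1 : c * ∑ a with c < g a, π a ≤ ∑ a, π a * g a := by
      rw [mul_sum]
      refine (sum_le_sum fun a ha => ?_).trans (sum_le_sum_of_subset_of_nonneg
        (filter_subset (fun a => c < g a) univ) fun a _ _ => mul_nonneg (hπ a) (hg a))
      rw [mul_comm]
      exact mul_le_mul_of_nonneg_left (mem_filter.1 ha).2.le (hπ a)
    exact le_of_mul_le_mul_left (h1.trans h) hc

/-! ### The reservoir -/

/-- The vector `q`, with the coordinates outside `M` (the reservoir) scaled down so as to lose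
total mass `μ`. -/
def drain {n : ℕ} (q : Fin n → ℝ) (M : Finset (Fin n)) (μ : ℝ) : Fin n → ℝ :=
  fun i => if i ∈ M then q i else q i * (1 - μ / ∑ j ∈ Mᶜ, q j)

section Drain

variable {n : ℕ} {q : Fin n → ℝ} {M : Finset (Fin n)}

lemma sum_ite_notMem (g : Fin n → ℝ) :
    ∑ i, (if i ∈ M then 0 else g i) = ∑ i ∈ Mᶜ, g i := by
  rw [← sum_filter_add_sum_filter_not univ (· ∈ M)]
  rw [sum_eq_zero (s := univ.filter (· ∈ M)) (fun i hi => if_pos (mem_filter.1 hi).2), zero_add]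
  refine sum_congr (by ext; simp) fun i hi => if_neg (mem_compl.1 hi)

lemma drain_nonneg (hq : ∀ i, 0 ≤ q i) {μ : ℝ} (hμ : μ ≤ ∑ j ∈ Mᶜ, q j) (i : Fin n) :
    0 ≤ drain q M μ i := by
  unfold drain
  split_ifs
  · exact hq i
  · exact mul_nonneg (hq i) (sub_nonneg.2 (div_le_one_of_le₀ hμ (sum_nonneg fun j _ => hq j)))

lemma drain_add_nonneg (hq : ∀ i, 0 ≤ q i) {μ : ℝ} (hμ : μ ≤ ∑ j ∈ Mᶜ, q j) {x : Fin n → ℝ}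
    (hxM : ∀ i ∉ M, x i = 0) (hx : ∀ i, 0 ≤ q i + x i) (i : Fin n) :
    0 ≤ drain q M μ i + x i := by
  by_cases h : i ∈ M
  · simpa [drain, h] using hx i
  · rw [hxM i h, add_zero]; exact drain_nonneg hq hμ i

lemma drain_sub (μ : ℝ) (i : Fin n) :
    drain q M μ i - q i = -(if i ∈ M then 0 else q i * (μ / ∑ j ∈ Mᶜ, q j)) := by
  unfold drain; split_ifs <;> ring

lemma drain_add_mem_stdSimplex (hq : q ∈ stdSimplex ℝ (Fin n)) (hR : 0 < ∑ j ∈ Mᶜ, q j)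
    {x : Fin n → ℝ} (hxM : ∀ i ∉ M, x i = 0) (hx : ∀ i, 0 ≤ q i + x i)
    (hS : ∑ i, x i ≤ ∑ j ∈ Mᶜ, q j) :
    (fun i => drain q M (∑ i, x i) i + x i) ∈ stdSimplex ℝ (Fin n) := by
  refine ⟨drain_add_nonneg hq.1 hS hxM hx, ?_⟩
  have : ∀ i, drain q M (∑ i, x i) i + x i =
      q i - (if i ∈ M then 0 else q i * ((∑ i, x i) / ∑ j ∈ Mᶜ, q j)) + x i := fun i => by
    linarith [drain_sub (q := q) (M := M) (∑ i, x i) i]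
  simp_rw [this]
  rw [sum_add_distrib, sum_sub_distrib, hq.2, sum_ite_notMem, ← sum_mul, mul_div_cancel₀ _ hR.ne']
  ring

/-- Changing the reservoir only adds to the distance, so far perturbations stay far without loss. -/
lemma sum_abs_le_l1Dist_drain_add {x : Fin n → ℝ} (hxM : ∀ i ∉ M, x i = 0) (μ : ℝ) :
    ∑ i, |x i| ≤ l1Dist (fun i => drain q M μ i + x i) q := by
  refine sum_le_sum fun i _ => ?_
  by_cases h : i ∈ M
  · simp [drain, h]
  · simp [hxM i h]

/-- The reservoir moves by `|∑ x| ≤ ∑ |x|`, which at most doubles the distance. -/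
lemma l1Dist_drain_add_le (hq : ∀ i, 0 ≤ q i) (hR : 0 < ∑ j ∈ Mᶜ, q j) (x : Fin n → ℝ) :
    l1Dist (fun i => drain q M (∑ i, x i) i + x i) q ≤ 2 * ∑ i, |x i| := by
  have h1 : ∀ i, |drain q M (∑ i, x i) i + x i - q i| ≤
      |x i| + (if i ∈ M then 0 else q i * (|∑ i, x i| / ∑ j ∈ Mᶜ, q j)) := by
    intro i
    have h2 : drain q M (∑ i, x i) i + x i - q i =
        x i + -(if i ∈ M then 0 else q i * ((∑ i, x i) / ∑ j ∈ Mᶜ, q j)) := by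
      rw [← drain_sub]; ring
    rw [h2]
    refine (abs_add_le _ _).trans (add_le_add_right ?_ _)
    rw [abs_neg]
    split_ifs
    · simp
    · rw [abs_mul, abs_div, abs_of_nonneg (hq i), abs_of_pos hR]
  refine (sum_le_sum fun i _ => h1 i).trans ?_
  rw [sum_add_distrib, sum_ite_notMem, ← sum_mul, mul_div_cancel₀ _ hR.ne', two_mul]
  exact add_le_add_right (abs_sum_le_sum_abs _ _) _

/-- The mass of the reservoir has little influence on the tester. -/
lemma abs_poissonAccept_drain_sub_le (T : Tester n) {m : ℝ} (hm : 0 ≤ m) (hq : ∀ i, 0 ≤ q i)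
    (hR : 1 / 2 ≤ ∑ j ∈ Mᶜ, q j) {x : Fin n → ℝ} (hxM : ∀ i ∉ M, x i = 0)
    (hx : ∀ i, 0 ≤ q i + x i) {μ S : ℝ} (hμ : μ ≤ 1 / 4) (hS : S ≤ 1 / 2)
    (hmS : m * (S - μ) ^ 2 ≤ 1 / 1000) :
    |poissonAccept T m (fun i => drain q M S i + x i) -
      poissonAccept T m (fun i => drain q M μ i + x i)| ≤ 1 / 10 := by
  set R := ∑ j ∈ Mᶜ, q j with hRdef
  have hR0 : 0 < R := by linarith
  have hμR : 0 < 1 - μ / R := by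
    rw [sub_pos, div_lt_one hR0]; linarith
  set b : Fin n → ℝ := fun i => drain q M μ i + x i with hb
  set p : Fin n → ℝ := fun i => drain q M S i + x i with hp
  have hb0 : ∀ i, 0 ≤ b i := drain_add_nonneg hq (by linarith) hxM hx
  have hp0 : ∀ i, 0 ≤ p i := drain_add_nonneg hq (by linarith) hxM hx
  have hpb : ∀ i, b i = 0 → p i = 0 := by
    intro i hi
    by_cases h : i ∈ M
    · simpa [hb, hp, drain, h] using hi
    · simp only [hb, drain, h, if_false, hxM i h, add_zero] at hi
      have hqi : q i = 0 := (mul_eq_zero.1 hi).resolve_right hμR.ne'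
      simp [hp, drain, h, hxM i h, hqi]
  -- Only the reservoir contributes. There `b ≥ q / 2`, and `R ≥ 1 / 2` gives the constant `4`.
  have hE : ∑ i, (p i - b i) * (p i - b i) / b i ≤ 4 * (S - μ) ^ 2 := by
    have h1 : ∀ i, (p i - b i) * (p i - b i) / b i ≤
        (if i ∈ M then 0 else q i * (2 * (S - μ) ^ 2 / R ^ 2)) := by
      intro i
      by_cases h : i ∈ M
      · simp [hb, hp, drain, h]
      · simp only [hb, hp, drain, h, if_false, hxM i h, add_zero]
        rcases (hq i).eq_or_lt with h0 | h0
        · simp [← h0]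
        · rw [div_le_iff₀ (mul_pos h0 hμR)]
          have h2 : (1 : ℝ) / 2 ≤ 1 - μ / R := by
            have : μ / R ≤ 1 / 2 := by rw [div_le_iff₀ hR0]; linarith
            linarith
          calc _ = q i * q i * ((S - μ) ^ 2 / R ^ 2) := by rw [← hRdef]; ring
            _ ≤ q i * q i * ((S - μ) ^ 2 / R ^ 2 * (2 * (1 - μ / R))) := by
              gcongr
              exact le_mul_of_one_le_right (by positivity) (by linarith)
            _ = _ := by ring
    refine (sum_le_sum fun i _ => h1 i).trans ?_
    rw [sum_ite_notMem, ← sum_mul, ← hRdef]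
    calc R * (2 * (S - μ) ^ 2 / R ^ 2) = 2 * (S - μ) ^ 2 / R := by field_simp
      _ ≤ 4 * (S - μ) ^ 2 := by
        rw [div_le_iff₀ hR0]
        nlinarith [sq_nonneg (S - μ)]
  -- With signs `+1` on `p`, `-1` on `b` and base `b`, the bound becomes `exp (m χ²) - 1`.
  have hchi := sq_sum_mul_poissonAccept_le T hm (fun c : Bool => if c then (1 : ℝ) else -1)
    (fun c : Bool => if c then p else b) (b := b) (fun c i => by cases c <;> simp [hp0, hb0]) hb0
    (fun c i hi => by cases c <;> simp [hpb i hi, hi])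
  simp only [Fintype.sum_bool, if_true, Bool.false_eq_true, if_false, sub_self, zero_mul, mul_zero,
    zero_div, sum_const_zero, Real.exp_zero, one_mul, mul_one] at hchi
  have hexp : Real.exp (m * ∑ i, (p i - b i) * (p i - b i) / b i) ≤ 1 + 1 / 100 := by
    have h1 : m * ∑ i, (p i - b i) * (p i - b i) / b i ≤ 1 / 250 := by
      have := mul_le_mul_of_nonneg_left hE hm
      linarith
    refine (Real.exp_le_exp.2 h1).trans ?_
    have := Real.exp_bound_div_one_sub_of_interval' (x := 1 / 250) (by norm_num) (by norm_num)
    refine this.le.trans (by norm_num)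
  refine abs_le_of_sq_le_sq (le_trans (le_of_eq (by ring)) (hchi.trans ?_)) (by norm_num)
  linarith

end Drain

/-! ### Two indistinguishable priors rule out a tester -/

/-- **Two random priors.** A tester does not exist if two families of perturbations, the first
mostly close to and the second mostly far from `q`, look alike. -/
lemma not_distinguishes_of_priors {n : ℕ} (T : Tester n) {q : Fin n → ℝ}
    (hq : q ∈ stdSimplex ℝ (Fin n)) {M : Finset (Fin n)} (hR : 1 / 2 ≤ ∑ j ∈ Mᶜ, q j)
    {ε₁ ε₂ μ : ℝ} (hμ : μ ≤ 1 / 4) (m : ℝ≥0) {α β : Type*} [Fintype α] [Fintype β]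
    {π : α → ℝ} {ϖ : β → ℝ} (hπ : ∀ a, 0 ≤ π a) (hϖ : ∀ b, 0 ≤ ϖ b) (hπ1 : ∑ a, π a = 1)
    (hϖ1 : ∑ b, ϖ b = 1) {X : α → Fin n → ℝ} {Y : β → Fin n → ℝ}
    (hXM : ∀ a, ∀ i ∉ M, X a i = 0) (hYM : ∀ b, ∀ i ∉ M, Y b i = 0)
    (hX : ∀ a i, 0 ≤ q i + X a i) (hY : ∀ b i, 0 ≤ q i + Y b i)
    (A : Finset α) (B : Finset β) (hA : ∑ a ∈ A, π a ≤ 1 / 10) (hB : ∑ b ∈ B, ϖ b ≤ 1 / 10)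
    (hAc : ∀ a ∉ A, 2 * ∑ i, |X a i| ≤ ε₁ ∧ ∑ i, X a i ≤ 1 / 2 ∧
      m * (∑ i, X a i - μ) ^ 2 ≤ 1 / 1000)
    (hBc : ∀ b ∉ B, ε₂ ≤ ∑ i, |Y b i| ∧ ∑ i, Y b i ≤ 1 / 2 ∧
      m * (∑ i, Y b i - μ) ^ 2 ≤ 1 / 1000)
    (hdiff : |∑ a, π a * poissonAccept T m (fun i => drain q M μ i + X a i) -
      ∑ b, ϖ b * poissonAccept T m (fun i => drain q M μ i + Y b i)| ≤ 1 / 5) :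
    ¬ T.Distinguishes q ε₁ ε₂ (1 / 5) m := by
  classical
  intro hT
  have hR0 : 0 < ∑ j ∈ Mᶜ, q j := by linarith
  have hm : (0 : ℝ) ≤ m := m.2
  -- Freezing the reservoir turns success `4/5` into `7/10`. The averages are then at least `0.63`
  -- and at most `0.1 + 0.3`, more than `1/5` apart.
  have hlow : (1 - 1 / 10) * (7 / 10) ≤
      ∑ a, π a * poissonAccept T m (fun i => drain q M μ i + X a i) := by
    have h1 : ∑ a ∈ A, π a + ∑ a ∈ Aᶜ, π a = 1 := by rw [sum_add_sum_compl, hπ1]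
    have h2 : (∑ a ∈ Aᶜ, π a) * (7 / 10) ≤
        ∑ a ∈ Aᶜ, π a * poissonAccept T m (fun i => drain q M μ i + X a i) := by
      rw [sum_mul]
      refine sum_le_sum fun a ha => mul_le_mul_of_nonneg_left ?_ (hπ a)
      obtain ⟨h3, h4, h5⟩ := hAc a (mem_compl.1 ha)
      have h6 := drain_add_mem_stdSimplex hq hR0 (hXM a) (hX a) (h4.trans hR)
      have h7 := (hT _ h6).1 ((l1Dist_drain_add_le hq.1 hR0 (X a)).trans h3)
      rw [probClose_eq_poissonAccept T m h6] at h7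
      have h8 := abs_le.1 (abs_poissonAccept_drain_sub_le T hm hq.1 hR (hXM a) (hX a) hμ h4 h5)
      linarith [h8.2]
    have h3 : ∑ a ∈ Aᶜ, π a * poissonAccept T m (fun i => drain q M μ i + X a i) ≤
        ∑ a, π a * poissonAccept T m (fun i => drain q M μ i + X a i) :=
      sum_le_sum_of_subset_of_nonneg (subset_univ _) fun a _ _ => mul_nonneg (hπ a)
        (poissonAccept_nonneg T hm (drain_add_nonneg hq.1 (by linarith) (hXM a) (hX a)))
    linarith
  have hhigh : ∑ b, ϖ b * poissonAccept T m (fun i => drain q M μ i + Y b i) ≤ 4 / 10 := by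
    rw [← sum_add_sum_compl B]
    have h1 : ∑ b ∈ B, ϖ b * poissonAccept T m (fun i => drain q M μ i + Y b i) ≤
        ∑ b ∈ B, ϖ b := sum_le_sum fun b _ => mul_le_of_le_one_right (hϖ b)
      (poissonAccept_le_one T hm (drain_add_nonneg hq.1 (by linarith) (hYM b) (hY b)))
    have h2 : ∑ b ∈ Bᶜ, ϖ b * poissonAccept T m (fun i => drain q M μ i + Y b i) ≤
        (∑ b ∈ Bᶜ, ϖ b) * (3 / 10) := by
      rw [sum_mul]
      refine sum_le_sum fun b hb => mul_le_mul_of_nonneg_left ?_ (hϖ b)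
      obtain ⟨h3, h4, h5⟩ := hBc b (mem_compl.1 hb)
      have h6 := drain_add_mem_stdSimplex hq hR0 (hYM b) (hY b) (h4.trans hR)
      have h7 := (hT _ h6).2 (h3.trans (sum_abs_le_l1Dist_drain_add (hYM b) _))
      rw [probClose_eq_poissonAccept T m h6] at h7
      have h8 := abs_le.1 (abs_poissonAccept_drain_sub_le T hm hq.1 hR (hYM b) (hY b) hμ h4 h5)
      linarith [h8.1]
    have h3 : ∑ b ∈ Bᶜ, ϖ b ≤ 1 := by
      rw [← hϖ1]
      exact sum_le_sum_of_subset_of_nonneg (subset_univ _) fun b _ _ => hϖ b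
    linarith
  have := (abs_le.1 hdiff).2
  linarith

/-! ### Tolerant testing: perturbations with matching moments -/

/-- Random perturbations of one coordinate with matching moments look alike. -/
lemma abs_sum_mul_poissonAccept_update_le {n : ℕ} (T : Tester n) {m H : ℝ} (hm : 0 ≤ m)
    (hH : 0 < H) (hmH : m ≤ H / 400) {κ : Type*} [Fintype κ] {y u v : κ → ℝ}
    (hu : ∀ k, 0 ≤ u k) (hv : ∀ k, 0 ≤ v k) (hu1 : ∑ k, u k = 1) (hv1 : ∑ k, v k = 1)
    {K : ℕ} (hK : 0 < K) (hmom : ∀ r < K, ∑ k, (u k - v k) * y k ^ r = 0) {Λ : ℝ}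
    (hyΛ : ∀ k, |y k| ≤ Λ) {d δ : Fin n → ℝ} (hd : ∀ i, 0 ≤ d i)
    (hnn : ∀ i k, 0 ≤ d i + δ i * y k) (hδH : ∀ i, H * (δ i * Λ) ^ 2 ≤ d i + 1 / H)
    (i : Fin n) (f : Fin n → κ) :
    |∑ k, (u k - v k) * poissonAccept T m
      (fun j => d j + δ j * y (Function.update f i k j))| ≤ 3 * (1 / 10) ^ K := by
  -- The extra `1 / H` keeps the base positive when `d i = 0`; the base need not have mass one.
  set b : Fin n → ℝ := fun j => if j = i then d i + 1 / H else d j + δ j * y (f j) with hb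
  have hH' : 0 < 1 / H := by positivity
  have hbi : 0 < d i + 1 / H := by linarith [hd i]
  have hchi := sq_sum_mul_poissonAccept_le T hm (fun k => u k - v k)
    (fun k j => d j + δ j * y (Function.update f i k j)) (b := b) (fun k j => hnn j _)
    (fun j => by
      simp only [hb]; split_ifs
      · exact hbi.le
      · exact hnn j _)
    (fun k j hj => by
      by_cases h : j = i
      · simp only [hb, h, if_true] at hj; linarith
      · simpa [hb, h] using hj)
  have hsum : ∀ k k', m * ∑ j, (d j + δ j * y (Function.update f i k j) - b j) *
      (d j + δ j * y (Function.update f i k' j) - b j) / b j =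
      (m / (d i + 1 / H)) * ((δ i * y k - 1 / H) * (δ i * y k' - 1 / H)) := by
    intro k k'
    rw [sum_eq_single i]
    · simp only [hb, if_true, Function.update_self]
      ring
    · intro j _ hj
      simp [hb, hj]
    · simp
  simp only [hsum] at hchi
  -- Translating the points by `1 / H` preserves the vanishing of the first `K` moments.
  have hmom' : ∀ r < K, ∑ k, (u k - v k) * (δ i * y k - 1 / H) ^ r = 0 := by
    intro r hr
    simp_rw [sub_eq_add_neg (δ i * _), add_pow, mul_sum]
    rw [sum_comm]
    refine sum_eq_zero fun s hs => ?_
    have hs' : s < K := by have := mem_range.1 hs; omega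
    calc _ = (δ i ^ s * (-(1 / H)) ^ (r - s) * r.choose s) * ∑ k, (u k - v k) * y k ^ s := by
          rw [mul_sum]
          exact sum_congr rfl fun k _ => by rw [mul_pow]; ring
      _ = 0 := by rw [hmom s hs', mul_zero]
  have hYabs : ∀ k, m * (δ i * y k - 1 / H) ^ 2 ≤ (d i + 1 / H) / 100 := by
    intro k
    have h1 : (δ i * y k) ^ 2 ≤ (δ i * Λ) ^ 2 := by
      rw [mul_pow, mul_pow]
      refine mul_le_mul_of_nonneg_left ?_ (sq_nonneg _)
      rw [← sq_abs]
      exact pow_le_pow_left₀ (abs_nonneg _) (hyΛ k) 2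
    have h2 : (δ i * y k - 1 / H) ^ 2 ≤ 2 * (δ i * Λ) ^ 2 + 2 * (1 / H) ^ 2 := by
      nlinarith [sq_nonneg (δ i * y k + 1 / H)]
    have h3 : H * (1 / H) ^ 2 = 1 / H := by field_simp
    calc m * (δ i * y k - 1 / H) ^ 2 ≤ H / 400 * (2 * (δ i * Λ) ^ 2 + 2 * (1 / H) ^ 2) := by
          gcongr
      _ = (H * (δ i * Λ) ^ 2 + H * (1 / H) ^ 2) / 200 := by ring
      _ ≤ _ := by
        have := hδH i
        have := hd i
        rw [h3]; linarith
  have hY : ∀ k k', |m / (d i + 1 / H) * ((δ i * y k - 1 / H) * (δ i * y k' - 1 / H))| ≤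
      1 / 100 := by
    intro k k'
    rw [div_mul_eq_mul_div, abs_div, abs_of_pos hbi, div_le_iff₀ hbi, abs_mul, abs_of_nonneg hm]
    have h1 : |(δ i * y k - 1 / H) * (δ i * y k' - 1 / H)| ≤
        ((δ i * y k - 1 / H) ^ 2 + (δ i * y k' - 1 / H) ^ 2) / 2 := by
      rw [abs_le]
      constructor
      · nlinarith [sq_nonneg ((δ i * y k - 1 / H) + (δ i * y k' - 1 / H))]
      · nlinarith [sq_nonneg ((δ i * y k - 1 / H) - (δ i * y k' - 1 / H))]
    have := mul_le_mul_of_nonneg_left h1 hm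
    linarith [hYabs k, hYabs k']
  have hfin := sum_sum_mul_exp_le_of_moments (fun k => u k - v k) (fun k => δ i * y k - 1 / H) hK
    hmom' (ρ := 1 / 100) (by norm_num) hY
  have habs : ∑ k, |u k - v k| ≤ 2 := by
    calc _ ≤ ∑ k, (u k + v k) := sum_le_sum fun k _ => abs_le.2
          ⟨by linarith [hu k, hv k], by linarith [hu k, hv k]⟩
      _ = 2 := by rw [sum_add_distrib, hu1, hv1]; norm_num
  have habs0 : 0 ≤ ∑ k, |u k - v k| := sum_nonneg fun k _ => abs_nonneg _
  refine abs_le_of_sq_le_sq (hchi.trans (hfin.trans ?_)) (by positivity)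
  calc (∑ k, |u k - v k|) ^ 2 * (2 * (1 / 100) ^ K) ≤ 2 ^ 2 * (2 * (1 / 100) ^ K) := by gcongr
    _ = 8 * ((1 / 10) ^ K) ^ 2 := by rw [← pow_mul, mul_comm K 2, pow_mul]; norm_num; ring
    _ ≤ _ := by nlinarith [sq_nonneg ((1 / 10 : ℝ) ^ K)]

set_option maxHeartbeats 1000000 in
/-- The lower bound for tolerant testing, for a given profile `δ` of the perturbation. -/
lemma lt_of_distinguishes_of_tolerance {n : ℕ} (T : Tester n) {q : Fin n → ℝ}
    (hq : q ∈ stdSimplex ℝ (Fin n)) {M : Finset (Fin n)} (hR : 1 / 2 ≤ ∑ j ∈ Mᶜ, q j)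
    {ε₁ ε₂ : ℝ} (hε₁ : 0 < ε₁) (hε : ε₁ < ε₂) (hε₂ : ε₂ < 1 / 100) {m : ℝ≥0} {L : ℕ} (hL : 1 ≤ L)
    (hn : (n : ℝ) ≤ 10 ^ L) {δ : Fin n → ℝ} (hδ : ∀ i, 0 ≤ δ i) (hδq : ∀ i, δ i ≤ q i)
    (hδM : ∀ i ∉ M, δ i = 0) (hδ1 : ∑ i, δ i = ε₂) {H : ℝ} (hH : 0 < H)
    (hδH : ∀ i, H * (δ i * (480 * L ^ 3 * (ε₂ / ε₁))) ^ 2 ≤ q i + 1 / H)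
    (hδ2 : H * (L * ∑ i, δ i ^ 2) ≤ 1 / 400) (hT : T.Distinguishes q ε₁ ε₂ (1 / 5) m) :
    H / 400 < m := by
  classical
  by_contra hmH
  push Not at hmH
  have hm : (0 : ℝ) ≤ m := m.2
  have hL1 : (1 : ℝ) ≤ L := by exact_mod_cast hL
  have hε₂0 : 0 < ε₂ := hε₁.trans hε
  -- Chosen so that under `u` the mean of `2 ∑ |X|` is at most `2 ε₂ (6 L ϑ) = ε₁ / 40`, and
  -- Markov's inequality applies.
  set ϑ := ε₁ / (480 * L * ε₂) with hϑ
  have hϑ0 : 0 < ϑ := by positivity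
  have hϑε : L * ϑ * ε₂ = ε₁ / 480 := by rw [hϑ]; field_simp
  have hLϑ : L * ϑ ≤ 1 / 480 := by
    by_contra h; push Not at h
    nlinarith
  obtain ⟨κ, _, y, u, v, hu, hv, hu1, hv1, hmom, hy1, hyL, hvy, huy, hvy1, huy2, hvy2⟩ :=
    exists_matching_moments hL hϑ0 (by linarith)
  have hLϑ2 : (L : ℝ) ^ 2 / ϑ = 480 * L ^ 3 * (ε₂ / ε₁) := by rw [hϑ]; field_simp
  have hyabs : ∀ k, |y k| ≤ 480 * L ^ 3 * (ε₂ / ε₁) := fun k => by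
    rw [← hLϑ2]
    refine abs_le.2 ⟨?_, hyL k⟩
    have h1 : 1 ≤ (L : ℝ) ^ 2 / ϑ := by
      rw [le_div_iff₀ hϑ0]; nlinarith
    linarith [hy1 k]
  set eu := ∑ k, u k * y k with heu
  have hev : ∑ k, v k * y k = eu := by
    have := hmom 1 (by omega)
    simp only [pow_one, sub_mul, sum_sub_distrib] at this
    linarith
  set μ := ∑ i, δ i * eu with hμdef
  have hμ : μ ≤ 1 / 4 := by
    have h1 : eu ≤ 6 * L * ϑ := (sum_le_sum fun k _ =>
      mul_le_mul_of_nonneg_left (le_abs_self _) (hu k)).trans huy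
    rw [hμdef, ← sum_mul, hδ1]
    have h2 := mul_le_mul_of_nonneg_left h1 hε₂0.le
    linarith
  set X : (Fin n → κ) → Fin n → ℝ := fun f i => δ i * y (f i) with hX
  have hXM : ∀ f, ∀ i ∉ M, X f i = 0 := fun f i hi => by simp [hX, hδM i hi]
  have hX0 : ∀ f i, 0 ≤ q i + X f i := fun f i => by
    have := mul_le_mul_of_nonneg_left (hy1 (f i)) (hδ i)
    simp only [hX]; linarith [hδq i]
  set W : (κ → ℝ) → (Fin n → κ) → ℝ := fun w f => ∏ i, w (f i) with hW
  have hW0 : ∀ w : κ → ℝ, (∀ k, 0 ≤ w k) → ∀ f, 0 ≤ W w f := fun w hw f =>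
    prod_nonneg fun i _ => hw _
  have hW1 : ∀ w : κ → ℝ, ∑ k, w k = 1 → ∑ f, W w f = 1 := fun w hw =>
    sum_prod_weights (W := fun _ => w) fun _ => hw
  have hmean : ∀ w : κ → ℝ, ∑ k, w k = 1 →
      ∑ f, W w f * ∑ i, |X f i| = ε₂ * ∑ k, w k * |y k| := by
    intro w hw
    have h1 : ∑ f, W w f * ∑ i, |X f i| =
        prodMean (fun _ : Fin n => w) (fun f => ∑ i, δ i * |y (f i)|) := by
      simp only [prodMean, hW, hX, abs_mul, abs_of_nonneg (hδ _)]
    rw [h1, prodMean_sum, ← hδ1, sum_mul]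
    refine sum_congr rfl fun i _ => ?_
    rw [prodMean_coord hw i (fun k => δ i * |y k|), mul_sum]
    exact sum_congr rfl fun k _ => by ring
  -- Chebyshev's inequality. Both priors have the same mean `μ` because the first moments of `u` and
  -- `v` agree.
  have hvar : ∀ w : κ → ℝ, (∀ k, 0 ≤ w k) → ∑ k, w k = 1 → ∑ k, w k * y k = eu →
      ∑ k, w k * y k ^ 2 ≤ 8 * L →
      ∑ f with 1 / 1000 < m * (∑ i, X f i - μ) ^ 2, W w f ≤ 1 / 20 := by
    intro w hw0 hw1 hwe hw2
    refine sum_filter_lt_le (hW0 w hw0) (fun f => by positivity) (by norm_num) ?_ (by norm_num)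
    have h1 : ∑ f, W w f * (m * (∑ i, X f i - μ) ^ 2) =
        m * prodMean (fun _ : Fin n => w) (fun f => (∑ i, δ i * (y (f i) - eu)) ^ 2) := by
      rw [prodMean, mul_sum]
      refine sum_congr rfl fun f _ => ?_
      simp only [hX, hμdef, mul_sub, sum_sub_distrib, hW]
      ring
    have h2 : ∑ k, w k * (y k - eu) = 0 := by
      simp only [mul_sub, sum_sub_distrib, ← sum_mul, hwe, hw1]; ring
    have h3 : ∑ k, w k * (y k - eu) ^ 2 ≤ 8 * L := by
      have : ∑ k, w k * (y k - eu) ^ 2 = ∑ k, w k * y k ^ 2 - eu ^ 2 := by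
        have : ∀ k, w k * (y k - eu) ^ 2 = w k * y k ^ 2 - 2 * eu * (w k * y k) + eu ^ 2 * w k :=
          fun k => by ring
        simp only [this, sum_add_distrib, sum_sub_distrib, ← mul_sum, hwe, hw1]; ring
      rw [this]; nlinarith [sq_nonneg eu]
    rw [h1, prodMean_sq_sum hw1 h2]
    have h4 : 0 ≤ ∑ i, δ i ^ 2 := sum_nonneg fun i _ => sq_nonneg _
    calc (m : ℝ) * ((∑ i, δ i ^ 2) * ∑ k, w k * (y k - eu) ^ 2)
        ≤ H / 400 * ((∑ i, δ i ^ 2) * (8 * L)) :=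
          mul_le_mul hmH (mul_le_mul_of_nonneg_left h3 h4)
            (mul_nonneg h4 (sum_nonneg fun k _ => mul_nonneg (hw0 k) (sq_nonneg _))) (by positivity)
      _ = H * (L * ∑ i, δ i ^ 2) / 50 := by ring
      _ ≤ _ := by linarith
  set A : Finset (Fin n → κ) := univ.filter (fun f => ε₁ < 2 * ∑ i, |X f i|) ∪
    univ.filter (fun f => 1 / 1000 < m * (∑ i, X f i - μ) ^ 2) with hA
  -- The null event is included so that outside `B` every coordinate has `|y| ≥ 1`, which forces
  -- distance at least `ε₂`.
  set B : Finset (Fin n → κ) := (univ.filter (fun f => 1 / 2 < ∑ i, |X f i|) ∪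
    univ.filter (fun f => 1 / 1000 < m * (∑ i, X f i - μ) ^ 2)) ∪
    univ.filter (fun f => W v f = 0) with hB
  have hunion : ∀ w : κ → ℝ, (∀ k, 0 ≤ w k) → ∀ s t : Finset (Fin n → κ),
      ∑ f ∈ s ∪ t, W w f ≤ ∑ f ∈ s, W w f + ∑ f ∈ t, W w f := fun w hw s t => by
    rw [← sum_union_inter]
    exact le_add_of_nonneg_right (sum_nonneg fun f _ => hW0 w hw f)
  have hAsum : ∑ f ∈ A, W u f ≤ 1 / 10 := by
    have h1 : ∑ f with ε₁ < 2 * ∑ i, |X f i|, W u f ≤ 1 / 40 := by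
      refine sum_filter_lt_le (hW0 u hu) (fun f => by positivity) hε₁.le ?_ (by norm_num)
      have h2 : ∑ f, W u f * (2 * ∑ i, |X f i|) = 2 * ∑ f, W u f * ∑ i, |X f i| := by
        rw [mul_sum]; exact sum_congr rfl fun f _ => by ring
      have h3 := mul_le_mul_of_nonneg_left huy hε₂0.le
      rw [h2, hmean u hu1]
      linarith
    have h2 := hvar u hu hu1 rfl huy2
    refine (hunion u hu _ _).trans ?_
    linarith
  have hBsum : ∑ f ∈ B, W v f ≤ 1 / 10 := by
    have h1 : ∑ f with 1 / 2 < ∑ i, |X f i|, W v f ≤ 1 / 20 := by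
      refine sum_filter_lt_le (hW0 v hv) (fun f => by positivity) (by norm_num) ?_ (by norm_num)
      rw [hmean v hv1]
      have h3 := mul_le_mul_of_nonneg_left hvy1 hε₂0.le
      linarith
    have h2 := hvar v hv hv1 hev hvy2
    have h3 : ∑ f with W v f = 0, W v f = 0 := sum_eq_zero fun f hf => (mem_filter.1 hf).2
    refine (hunion v hv _ _).trans ?_
    have := hunion v hv (univ.filter (fun f => 1 / 2 < ∑ i, |X f i|))
      (univ.filter (fun f => 1 / 1000 < m * (∑ i, X f i - μ) ^ 2))
    linarith
  refine not_distinguishes_of_priors T hq hR hμ m (hW0 u hu) (hW0 v hv) (hW1 u hu1) (hW1 v hv1)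
    hXM hXM hX0 hX0 A B hAsum hBsum ?_ ?_ ?_ hT
  · intro f hf
    simp only [hA, mem_union, mem_filter, mem_univ, true_and, not_or, not_lt] at hf
    refine ⟨hf.1, ?_, hf.2⟩
    have := sum_le_sum fun i (_ : i ∈ univ) => le_abs_self (X f i)
    linarith [hf.1]
  · intro f hf
    simp only [hB, mem_union, mem_filter, mem_univ, true_and, not_or, not_lt] at hf
    refine ⟨?_, ?_, hf.1.2⟩
    · rw [← hδ1]
      refine sum_le_sum fun i _ => ?_
      have : v (f i) ≠ 0 := fun h => hf.2 (prod_eq_zero (mem_univ i) h)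
      simp only [hX, abs_mul, abs_of_nonneg (hδ i)]
      exact le_mul_of_one_le_right (hδ i) (hvy _ this)
    · have := sum_le_sum fun i (_ : i ∈ univ) => le_abs_self (X f i)
      linarith [hf.1.1]
  · have hμR : μ ≤ ∑ j ∈ Mᶜ, q j := by linarith
    have hd := drain_nonneg (q := q) (M := M) hq.1 hμR
    have hcoord := abs_prodMean_sub_le (ι := Fin n) hu hv hu1 hv1
      (fun f => poissonAccept T m (fun i => drain q M μ i + X f i))
      (fun i f => abs_sum_mul_poissonAccept_update_le T hm hH hmH hu hv hu1 hv1
        (K := L + 2) (by omega) hmom hyabs hd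
        (fun i k => by
          by_cases h : i ∈ M
          · have := hX0 (fun _ => k) i
            simpa [drain, h, hX] using this
          · simp [hδM i h, hd i])
        (fun i => by
          by_cases h : i ∈ M
          · simpa [drain, h] using hδH i
          · have h1 := hd i
            have h2 : 0 < 1 / H := by positivity
            rw [hδM i h]; simp only [zero_mul]; nlinarith) i f)
    refine hcoord.trans ?_
    rw [Fintype.card_fin]
    have h10 : (10 : ℝ) ^ L * (1 / 10) ^ L = 1 := by rw [← mul_pow]; norm_num
    calc (n : ℝ) * (3 * (1 / 10) ^ (L + 2)) ≤ 10 ^ L * (3 * (1 / 10) ^ (L + 2)) := by gcongr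
      _ = (10 ^ L * (1 / 10) ^ L) * (3 / 100) := by rw [pow_add]; ring
      _ ≤ 1 / 5 := by rw [h10]; norm_num

/-! ### Identity testing: random signs -/

/-- Random independent signs multiply the exponential energies of the coordinates. -/
lemma prodMean_prodMean_exp_signs {n : ℕ} (x : Fin n → ℝ) :
    prodMean (fun (_ : Fin n) (_ : Bool) => (1 / 2 : ℝ)) (fun f =>
      prodMean (fun (_ : Fin n) (_ : Bool) => (1 / 2 : ℝ)) (fun g =>
        Real.exp (∑ i, x i * ((if f i then 1 else -1) * (if g i then 1 else -1))))) ≤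
      Real.exp (∑ i, x i ^ 2 / 2) := by
  -- For fixed `f` the relative signs are again uniform, so the inner average does not depend on
  -- `f`.
  have h1 : ∀ f : Fin n → Bool,
      prodMean (fun (_ : Fin n) (_ : Bool) => (1 / 2 : ℝ)) (fun g =>
        Real.exp (∑ i, x i * ((if f i then 1 else -1) * (if g i then 1 else -1)))) =
      ∏ i, Real.cosh (x i) := by
    intro f
    simp only [prodMean, Real.exp_sum, ← prod_mul_distrib]
    rw [← Fintype.prod_sum (fun (i : Fin n) (c : Bool) => (1 / 2 : ℝ) *
      Real.exp (x i * ((if f i then 1 else -1) * (if c then 1 else -1))))]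
    refine prod_congr rfl fun i _ => ?_
    rw [Fintype.sum_bool, Real.cosh_eq]
    cases f i <;> simp <;> ring
  simp only [h1]
  rw [prodMean_const (fun _ => by simp), Real.exp_sum]
  exact prod_le_prod (fun i _ => (Real.cosh_pos _).le) fun i _ => Real.cosh_le_exp_half_sq _

/-- The lower bound for identity testing, for a given profile `δ` of the perturbation. -/
lemma not_distinguishes_of_identity {n : ℕ} (T : Tester n) {q : Fin n → ℝ}
    (hq : q ∈ stdSimplex ℝ (Fin n)) {M : Finset (Fin n)} (hR : 1 / 2 ≤ ∑ j ∈ Mᶜ, q j)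
    {ε₁ ε₂ : ℝ} (hε₁ : 0 ≤ ε₁) (hε₂ : ε₂ ≤ 1 / 2) {m : ℝ≥0} {δ : Fin n → ℝ} (hδ : ∀ i, 0 ≤ δ i)
    (hδq : ∀ i, δ i ≤ q i) (hδM : ∀ i ∉ M, δ i = 0) (hδ1 : ∑ i, δ i = ε₂)
    (hδ4 : ∑ i, (m * (δ i ^ 2 / q i)) ^ 2 ≤ 1 / 50) (hδ2 : m * ∑ i, δ i ^ 2 ≤ 1 / 10000) :
    ¬ T.Distinguishes q ε₁ ε₂ (1 / 5) m := by
  have hm : (0 : ℝ) ≤ m := m.2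
  set s : Bool → ℝ := fun c => if c then 1 else -1 with hs
  have hs1 : ∀ c, |s c| = 1 := fun c => by cases c <;> simp [hs]
  set Y : (Fin n → Bool) → Fin n → ℝ := fun f i => δ i * s (f i) with hY
  have hYabs : ∀ f i, |Y f i| = δ i := fun f i => by
    simp only [hY, abs_mul, hs1, abs_of_nonneg (hδ i), mul_one]
  have hYM : ∀ f, ∀ i ∉ M, Y f i = 0 := fun f i hi => by simp [hY, hδM i hi]
  have hY0 : ∀ f i, 0 ≤ q i + Y f i := fun f i => by
    have := (abs_le.1 (hYabs f i).le).1
    linarith [hδq i]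
  set W : (Fin n → Bool) → ℝ := fun f => ∏ _i : Fin n, (1 / 2 : ℝ) with hW
  have hW0 : ∀ f, 0 ≤ W f := fun f => by positivity
  have hW1 : ∑ f, W f = 1 :=
    sum_prod_weights (ι := Fin n) (W := fun _ (_ : Bool) => (1 / 2 : ℝ)) fun _ => by simp
  have hvar : ∑ f with 1 / 1000 < m * (∑ i, Y f i - 0) ^ 2, W f ≤ 1 / 10 := by
    refine sum_filter_lt_le hW0 (fun f => by positivity) (by norm_num) ?_ (by norm_num)
    have h1 : ∑ f, W f * (m * (∑ i, Y f i - 0) ^ 2) =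
        m * prodMean (fun (_ : Fin n) (_ : Bool) => (1 / 2 : ℝ))
          (fun f => (∑ i, δ i * s (f i)) ^ 2) := by
      rw [prodMean, mul_sum]
      refine sum_congr rfl fun f _ => ?_
      simp only [hY, hW, sub_zero]
      ring
    rw [h1, prodMean_sq_sum (by simp) (by simp [hs])]
    have h2 : ∑ k, (1 / 2 : ℝ) * s k ^ 2 = 1 := by simp [hs]
    rw [h2, mul_one]
    linarith
  have hd0 : drain q M 0 = q := by ext i; simp [drain]
  refine not_distinguishes_of_priors T hq hR (μ := 0) (by norm_num) m (α := Unit)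
    (π := fun _ => 1) (fun _ => zero_le_one) hW0 (by simp) hW1 (X := fun _ _ => 0)
    (fun _ _ _ => rfl) hYM (fun _ i => by simpa using hq.1 i) hY0 ∅ _ (by simp) hvar ?_ ?_ ?_
  · intro _ _; simp [hε₁]
  · intro f hf
    simp only [mem_filter, mem_univ, true_and, not_lt] at hf
    refine ⟨?_, ?_, hf⟩
    · simp [hYabs, hδ1]
    · have := sum_le_sum fun i (_ : i ∈ univ) => le_abs_self (Y f i)
      simp only [hYabs, hδ1] at this
      linarith
  · have hchi := sq_sum_mul_poissonAccept_le T hm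
      (fun a : Option (Fin n → Bool) => a.elim (1 : ℝ) (fun f => -W f))
      (fun a => a.elim q (fun f i => q i + Y f i)) (b := q)
      (fun a i => by
        cases a with
        | none => exact hq.1 i
        | some f => exact hY0 f i) hq.1
      (fun a i hi => by
        cases a with
        | none => exact hi
        | some f =>
          have : δ i = 0 := le_antisymm (hi ▸ hδq i) (hδ i)
          simp [hY, hi, this])
    simp only [Fintype.sum_option, Option.elim_none, Option.elim_some, sub_self, zero_mul, mul_zero,
      zero_div, sum_const_zero, Real.exp_zero, one_mul, mul_one, add_sub_cancel_left,
      sum_neg_distrib, hW1, neg_mul, mul_neg, neg_neg] at hchi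
    have hexp : ∑ f, ∑ g, W f * W g * Real.exp (m * ∑ i, Y f i * Y g i / q i) ≤
        Real.exp (∑ i, (m * (δ i ^ 2 / q i)) ^ 2 / 2) := by
      refine le_trans (le_of_eq ?_) (prodMean_prodMean_exp_signs _)
      simp only [prodMean, mul_sum, hW, hY, hs]
      refine sum_congr rfl fun f _ => sum_congr rfl fun g _ => ?_
      rw [mul_assoc]
      congr 3
      exact sum_congr rfl fun i _ => by ring
    have hexp2 : Real.exp (∑ i, (m * (δ i ^ 2 / q i)) ^ 2 / 2) ≤ 1 + 1 / 25 := by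
      rw [← sum_div]
      refine (Real.exp_le_exp.2 (show _ ≤ (1 / 100 : ℝ) by linarith)).trans ?_
      have := Real.exp_bound_div_one_sub_of_interval' (x := 1 / 100) (by norm_num) (by norm_num)
      exact this.le.trans (by norm_num)
    simp only [hd0, Fintype.sum_unique, one_mul, add_zero]
    refine abs_le_of_sq_le_sq (le_trans (le_of_eq ?_) (hchi.trans ?_)) (by norm_num)
    · ring
    · simp only [sum_add_distrib, sum_neg_distrib, hW1]
      linarith

/-! ### Pairing by decreasing mass, and truncated profiles -/

section Order

variable {n : ℕ} (q : Fin n → ℝ)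

lemma mem_upTo {i j : Fin n} : j ∈ upTo q i ↔ q j < q i ∨ (q j = q i ∧ j ≤ i) := by
  simp [upTo]

lemma upTo_subset_upTo {i j : Fin n} (h : j ∈ upTo q i) : upTo q j ⊆ upTo q i := by
  intro k hk
  rw [mem_upTo] at *
  grind

lemma mem_upTo_or_ssubset (i j : Fin n) : j ∈ upTo q i ∨ upTo q i ⊂ upTo q j := by
  by_cases h : j ∈ upTo q i
  · exact Or.inl h
  · refine Or.inr ⟨upTo_subset_upTo q ?_, fun hs => h (hs ?_)⟩
    · rw [mem_upTo] at *; grind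
    · rw [mem_upTo]; exact Or.inr ⟨rfl, le_rfl⟩

/-- Enumerating the indices in the reverse of the order defining `upTo`. -/
lemma exists_equiv_mem_upTo_iff : ∃ d : Fin n ≃ Fin n, ∀ i j, j ∈ upTo q i ↔ d i ≤ d j := by
  have hle : ∀ i j, j ∈ upTo q i ↔ (upTo q j).card ≤ (upTo q i).card := fun i j => by
    refine ⟨fun h => card_le_card (upTo_subset_upTo q h), fun h => ?_⟩
    exact (mem_upTo_or_ssubset q i j).resolve_right fun hs => (card_lt_card hs).not_ge h
  have hpos : ∀ i, 0 < (upTo q i).card := fun i =>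
    card_pos.2 ⟨i, (mem_upTo q).2 (Or.inr ⟨rfl, le_rfl⟩)⟩
  have hcard : ∀ i, (upTo q i).card ≤ n := fun i => by
    simpa using card_le_univ (upTo q i)
  let f : Fin n → Fin n := fun i => ⟨n - (upTo q i).card, by
    have := hpos i; have := hcard i; omega⟩
  have hf : ∀ i j, j ∈ upTo q i ↔ f i ≤ f j := fun i j => by
    rw [hle, Fin.mk_le_mk]
    have := hcard i; have := hcard j; omega
  have hinj : Function.Injective f := fun i j hij => by
    have h1 := (hf i j).2 hij.le
    have h2 := (hf j i).2 hij.ge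
    rw [mem_upTo] at h1 h2
    grind
  exact ⟨Equiv.ofBijective f (Finite.injective_iff_bijective.1 hinj), hf⟩

variable {q}

lemma removeSmallest_ne_zero_iff {x : ℝ} {i : Fin n} :
    removeSmallest q x i ≠ 0 ↔ x < ∑ j ∈ upTo q i, q j ∧ q i ≠ 0 := by
  unfold removeSmallest
  split_ifs with h
  · simp [h]
  · simp [not_le.1 h]

/-- Every other index, in the order of decreasing mass, is perturbed, and the remaining ones, the
heavier of each pair, form the reservoir. -/
lemma exists_perturbed_set (hq : q ∈ stdSimplex ℝ (Fin n)) :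
    ∃ M : Finset (Fin n), 1 / 2 ≤ ∑ j ∈ Mᶜ, q j ∧
      (∀ i ∈ M, ∑ j ∈ upTo q i, q j ≤ 2 * ∑ j ∈ upTo q i with j ∈ M, q j) ∧
      ∀ (x : ℝ) (h : Fin n → ℝ), (∀ i, 0 ≤ h i) → (∀ i, h i ≤ 1) →
        (∀ i j, q j ≤ q i → h j ≤ h i) →
        ∑ i with removeSmallest q x i ≠ 0, h i ≤
          1 + 2 * ∑ i ∈ M with removeSmallest q x i ≠ 0, h i := by
  classical
  obtain ⟨d, hd⟩ := exists_equiv_mem_upTo_iff q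
  have hqd : ∀ i j, d i ≤ d j → q j ≤ q i := fun i j h => by
    rcases (mem_upTo q).1 ((hd i j).2 h) with h1 | h1
    · exact h1.le
    · exact h1.1.le
  -- `φ` moves to the next heavier index; truncated subtraction makes it fix the heaviest one, which
  -- `hshift` excludes.
  set φ : Fin n → Fin n := fun i => d.symm ⟨d i - 1, by have := (d i).2; omega⟩ with hφ
  have hdφ : ∀ i, ((d (φ i) : Fin n) : ℕ) = d i - 1 := fun i => by simp [hφ]
  have hqφ : ∀ i, q i ≤ q (φ i) := fun i => hqd _ _ (by
    rw [Fin.le_def, hdφ]; omega)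
  have hshift : ∀ (S S' : Finset (Fin n)) (h : Fin n → ℝ), (∀ i, 0 ≤ h i) →
      (∀ i j, q j ≤ q i → h j ≤ h i) → (∀ j ∈ S, (d j : ℕ) ≠ 0 ∧ φ j ∈ S') →
      ∑ j ∈ S, h j ≤ ∑ j ∈ S', h j := by
    intro S S' h h0 hmono hS
    have hinj : Set.InjOn φ S := fun a ha b hb hab => by
      have h1 := (hS a ha).1
      have h2 := (hS b hb).1
      have h3 : ((d (φ a) : Fin n) : ℕ) = d (φ b) := by rw [hab]
      rw [hdφ, hdφ] at h3
      exact d.injective (Fin.ext (by omega))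
    calc ∑ j ∈ S, h j ≤ ∑ j ∈ S, h (φ j) := sum_le_sum fun j _ => hmono _ _ (hqφ j)
      _ = ∑ j ∈ S.image φ, h j := (sum_image hinj).symm
      _ ≤ _ := sum_le_sum_of_subset_of_nonneg
        (image_subset_iff.2 fun j hj => (hS j hj).2) fun j _ _ => h0 j
  set M : Finset (Fin n) := univ.filter fun i => Odd (d i : ℕ) with hM
  have hMmem : ∀ i, i ∈ M ↔ Odd (d i : ℕ) := fun i => by simp [hM]
  refine ⟨M, ?_, ?_, ?_⟩
  · have h1 := hshift M Mᶜ q hq.1 (fun _ _ h => h) (fun j hj => by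
      rw [hMmem] at hj
      rw [Nat.odd_iff] at hj
      rw [mem_compl, hMmem, hdφ, Nat.odd_iff]
      omega)
    have h2 := sum_add_sum_compl M q
    rw [hq.2] at h2
    linarith
  · intro i hi
    rw [hMmem] at hi
    have h1 := hshift ((upTo q i).filter (· ∉ M)) ((upTo q i).filter (· ∈ M)) q hq.1
      (fun _ _ h => h) (fun j hj => by
        rw [mem_filter, hd, hMmem, Fin.le_def, Nat.odd_iff] at hj
        rw [Nat.odd_iff] at hi
        rw [mem_filter, hd, hMmem, Fin.le_def, hdφ, Nat.odd_iff]
        omega)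
    rw [← sum_filter_add_sum_filter_not (upTo q i) (· ∈ M)]
    linarith
  · intro x h h0 h1 hmono
    set S : Finset (Fin n) := univ.filter fun i => removeSmallest q x i ≠ 0 with hS
    have hup : ∀ i j, d i ≤ d j → j ∈ S → i ∈ S := fun i j hij hj => by
      simp only [hS, mem_filter, mem_univ, true_and, removeSmallest_ne_zero_iff] at hj ⊢
      refine ⟨hj.1.trans_le (sum_le_sum_of_subset_of_nonneg
        (upTo_subset_upTo q ((hd i j).2 hij)) fun k _ _ => hq.1 k), ?_⟩
      have h2 := hqd i j hij
      have h3 := (hq.1 j).lt_of_ne' hj.2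
      exact (h3.trans_le h2).ne'
    have hMS : M.filter (fun i => removeSmallest q x i ≠ 0) = S.filter (· ∈ M) := by
      ext; simp [hS, and_comm]
    rw [hMS, ← sum_filter_add_sum_filter_not S (· ∈ M)]
    have h2 := hshift ((S.filter (· ∉ M)).filter fun i => (d i : ℕ) ≠ 0) (S.filter (· ∈ M)) h h0
      hmono (fun j hj => by
        rw [mem_filter, mem_filter, hMmem, Nat.odd_iff] at hj
        refine ⟨hj.2, mem_filter.2 ⟨hup _ j ?_ hj.1.1, ?_⟩⟩
        · rw [Fin.le_def, hdφ]; omega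
        · rw [hMmem, hdφ, Nat.odd_iff]; omega)
    -- Rank `0` has no predecessor to pay for it; it accounts for the additive `1`.
    have h3 : ∑ i ∈ (S.filter (· ∉ M)).filter (fun i => ¬ (d i : ℕ) ≠ 0), h i ≤ 1 := by
      have hc : ((S.filter (· ∉ M)).filter (fun i => ¬ (d i : ℕ) ≠ 0)).card ≤ 1 := by
        refine card_le_one.2 fun a ha b hb => ?_
        rw [mem_filter, not_not] at ha hb
        exact d.injective (Fin.ext (ha.2.trans hb.2.symm))
      refine (sum_le_card_nsmul _ _ 1 fun i _ => h1 i).trans ?_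
      rw [nsmul_eq_mul, mul_one]
      exact_mod_cast hc
    rw [← sum_filter_add_sum_filter_not (S.filter (· ∉ M)) fun i => (d i : ℕ) ≠ 0]
    linarith

/-- A profile of perturbations proportional to `g`, truncated at `q`. -/
lemma exists_truncated_profile (hq : ∀ i, 0 ≤ q i) {M : Finset (Fin n)}
    (hM : ∀ i ∈ M, ∑ j ∈ upTo q i, q j ≤ 2 * ∑ j ∈ upTo q i with j ∈ M, q j)
    {x ε : ℝ} (hε : 0 ≤ ε) (hx : 2 * ε ≤ x) {g : Fin n → ℝ} (hg0 : ∀ i, 0 ≤ g i)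
    (hg : ∀ θ i j, q j ≤ q i → q i ≤ θ * g i → 0 < q i → q j ≤ θ * g j)
    (hG : 0 < ∑ i ∈ M with removeSmallest q x i ≠ 0, g i) :
    ∃ (θ : ℝ) (δ : Fin n → ℝ), 0 ≤ θ ∧
      θ ≤ ε / ∑ i ∈ M with removeSmallest q x i ≠ 0, g i ∧ (∀ i, 0 ≤ δ i) ∧
      (∀ i, δ i ≤ q i) ∧ (∀ i, δ i ≤ θ * g i) ∧ (∀ i ∉ M, δ i = 0) ∧ ∑ i, δ i = ε := by
  classical
  set G := ∑ i ∈ M with removeSmallest q x i ≠ 0, g i with hGdef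
  have hcont : Continuous fun θ : ℝ => ∑ i ∈ M, min (q i) (θ * g i) := by fun_prop
  have h0 : ∑ i ∈ M, min (q i) (0 * g i) = 0 :=
    sum_eq_zero fun i _ => by rw [zero_mul, min_eq_right (hq i)]
  have hθ0 : 0 ≤ ε / G := by positivity
  have h1 : ε ≤ ∑ i ∈ M, min (q i) (ε / G * g i) := by
    -- If some kept `i` is truncated, all lighter entries of `M` are too, and they carry at least
    -- half the mass of `upTo q i`, hence more than `x / 2 ≥ ε`. Otherwise the kept entries alone
    -- sum to `ε`.
    by_cases hex : ∃ i ∈ M, removeSmallest q x i ≠ 0 ∧ q i < ε / G * g i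
    · obtain ⟨i, hiM, hik, hi⟩ := hex
      rw [removeSmallest_ne_zero_iff] at hik
      have hqi : 0 < q i := (hq i).lt_of_ne' hik.2
      have h2 := hM i hiM
      have h3 : ∑ j ∈ upTo q i with j ∈ M, q j ≤ ∑ j ∈ M, min (q j) (ε / G * g j) := by
        calc ∑ j ∈ upTo q i with j ∈ M, q j
            ≤ ∑ j ∈ upTo q i with j ∈ M, min (q j) (ε / G * g j) := by
              refine sum_le_sum fun j hj => le_min le_rfl ?_
              have hj' := (mem_upTo q).1 (mem_filter.1 hj).1
              exact hg _ i j (hj'.elim le_of_lt fun h => h.1.le) hi.le hqi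
          _ ≤ _ := sum_le_sum_of_subset_of_nonneg
            (fun j hj => (mem_filter.1 hj).2)
            fun j _ _ => le_min (hq j) (mul_nonneg hθ0 (hg0 j))
      linarith [hik.1]
    · push Not at hex
      calc ε = ∑ i ∈ M with removeSmallest q x i ≠ 0, ε / G * g i := by
            rw [← mul_sum, ← hGdef, div_mul_cancel₀ _ hG.ne']
        _ ≤ ∑ i ∈ M with removeSmallest q x i ≠ 0, min (q i) (ε / G * g i) :=
          sum_le_sum fun i hi => le_min
            (hex i (mem_filter.1 hi).1 (mem_filter.1 hi).2) le_rfl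
        _ ≤ _ := sum_le_sum_of_subset_of_nonneg (filter_subset _ _)
          fun j _ _ => le_min (hq j) (mul_nonneg hθ0 (hg0 j))
  obtain ⟨θ, hθ, hθε⟩ := intermediate_value_Icc hθ0 hcont.continuousOn
    (show ε ∈ Set.Icc (∑ i ∈ M, min (q i) (0 * g i)) (∑ i ∈ M, min (q i) (ε / G * g i)) from
      ⟨h0.trans_le hε, h1⟩)
  refine ⟨θ, fun i => if i ∈ M then min (q i) (θ * g i) else 0, hθ.1, hθ.2, ?_, ?_, ?_, ?_, ?_⟩
  · intro i
    dsimp only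
    split_ifs
    · exact le_min (hq i) (mul_nonneg hθ.1 (hg0 i))
    · exact le_rfl
  · intro i
    dsimp only
    split_ifs
    · exact min_le_left _ _
    · exact hq i
  · intro i
    dsimp only
    split_ifs
    · exact min_le_right _ _
    · exact mul_nonneg hθ.1 (hg0 i)
  · intro i hi
    simp [hi]
  · rw [sum_ite_mem, univ_inter]
    exact hθε

end Order

/-! ### The three terms of the instance cost -/

section Bounds

variable {n : ℕ} {q : Fin n → ℝ}

lemma sum_removeSmallest_rpow (hq : ∀ i, 0 ≤ q i) (x : ℝ) {r : ℝ} (hr : r ≠ 0) :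
    ∑ i, |removeSmallest q x i| ^ r = ∑ i with removeSmallest q x i ≠ 0, q i ^ r := by
  rw [sum_filter]
  refine sum_congr rfl fun i _ => ?_
  split_ifs with h
  · have : removeSmallest q x i = q i := by
      unfold removeSmallest at h ⊢
      split_ifs with h'
      · simp [h'] at h
      · rfl
    rw [this, abs_of_nonneg (hq i)]
  · rw [not_not.1 h, abs_zero, Real.zero_rpow hr]

lemma sum_kept_rpow_le (hq : q ∈ stdSimplex ℝ (Fin n)) {M : Finset (Fin n)}
    (hM : ∀ (x : ℝ) (h : Fin n → ℝ), (∀ i, 0 ≤ h i) → (∀ i, h i ≤ 1) →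
        (∀ i j, q j ≤ q i → h j ≤ h i) →
        ∑ i with removeSmallest q x i ≠ 0, h i ≤
          1 + 2 * ∑ i ∈ M with removeSmallest q x i ≠ 0, h i) (x : ℝ) {r : ℝ} (hr : 0 ≤ r) :
    ∑ i with removeSmallest q x i ≠ 0, q i ^ r ≤
      1 + 2 * ∑ i ∈ M with removeSmallest q x i ≠ 0, q i ^ r := by
  have hq1 : ∀ i, q i ≤ 1 := fun i => by
    rw [← hq.2]; exact single_le_sum (fun j _ => hq.1 j) (mem_univ i)
  exact hM x _ (fun i => Real.rpow_nonneg (hq.1 i) r)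
    (fun i => Real.rpow_le_one (hq.1 i) (hq1 i) hr)
    (fun i j h => Real.rpow_le_rpow (hq.1 j) h hr)

/-- A profile of perturbations proportional to the `r`-th power of `q`, truncated at `q`. -/
lemma exists_rpow_profile (hq : ∀ i, 0 ≤ q i) {M : Finset (Fin n)}
    (hM : ∀ i ∈ M, ∑ j ∈ upTo q i, q j ≤ 2 * ∑ j ∈ upTo q i with j ∈ M, q j)
    {x ε : ℝ} (hε : 0 ≤ ε) (hx : 2 * ε ≤ x) {r : ℝ} (hr1 : r ≤ 1)
    (hG : 0 < ∑ i ∈ M with removeSmallest q x i ≠ 0, q i ^ r) :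
    ∃ (θ : ℝ) (δ : Fin n → ℝ), 0 ≤ θ ∧
      θ ≤ ε / ∑ i ∈ M with removeSmallest q x i ≠ 0, q i ^ r ∧ (∀ i, 0 ≤ δ i) ∧
      (∀ i, δ i ≤ q i) ∧ (∀ i, δ i ≤ θ * q i ^ r) ∧ (∀ i ∉ M, δ i = 0) ∧ ∑ i, δ i = ε := by
  refine exists_truncated_profile hq hM hε hx (fun i => Real.rpow_nonneg (hq i) r) ?_ hG
  intro θ i j hji hi hqi
  have hpow : 0 < q i ^ r := Real.rpow_pos_of_pos hqi r
  have hsplit : ∀ t : ℝ, 0 < t → t = t ^ (1 - r) * t ^ r := fun t ht => by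
    rw [← Real.rpow_add ht]; simp
  have h1 : q i ^ (1 - r) ≤ θ := by
    refine le_of_mul_le_mul_right ?_ hpow
    rwa [← hsplit _ hqi]
  rcases (hq j).eq_or_lt with h0 | h0
  · rw [← h0]
    exact mul_nonneg ((Real.rpow_nonneg hqi.le _).trans h1) (Real.rpow_nonneg le_rfl _)
  · calc q j = q j ^ (1 - r) * q j ^ r := hsplit _ h0
      _ ≤ θ * q j ^ r := by
        gcongr
        exact (Real.rpow_le_rpow h0.le hji (by linarith)).trans h1

variable {M : Finset (Fin n)} {ε₁ ε₂ x : ℝ} {m : ℝ≥0} {T : Tester n}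

/-- The flat profile `r = 0`: as `δ ≤ ε₂ / G` uniformly, the summand `1 / H` alone absorbs the
perturbation, and `H` comes out linear in `G ε₁ / ε₂ ^ 2`. -/
lemma card_kept_bound (hq : q ∈ stdSimplex ℝ (Fin n)) (hR : 1 / 2 ≤ ∑ j ∈ Mᶜ, q j)
    (hM : ∀ i ∈ M, ∑ j ∈ upTo q i, q j ≤ 2 * ∑ j ∈ upTo q i with j ∈ M, q j)
    (hε₁ : 0 ≤ ε₁) (hε : ε₁ < ε₂) (hε₂ : ε₂ < 1 / 100) (hx : 2 * ε₂ ≤ x) {L : ℕ} (hL : 1 ≤ L)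
    (hn : (n : ℝ) ≤ 10 ^ L) (hT : T.Distinguishes q ε₁ ε₂ (1 / 5) m) :
    (∑ i ∈ M with removeSmallest q x i ≠ 0, q i ^ (0 : ℝ)) * (ε₁ / ε₂ ^ 2) ≤
      192000 * L ^ 3 * m := by
  set G := ∑ i ∈ M with removeSmallest q x i ≠ 0, q i ^ (0 : ℝ) with hG
  have hG0 : 0 ≤ G := sum_nonneg fun i _ => Real.rpow_nonneg (hq.1 i) _
  have hε₂0 : 0 < ε₂ := hε₁.trans_lt hε
  rcases hε₁.eq_or_lt with rfl | hε₁
  · rw [zero_div, mul_zero]; positivity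
  rcases hG0.eq_or_lt with h0 | hG0
  · rw [← h0, zero_mul]; positivity
  have hL1 : (1 : ℝ) ≤ L := by exact_mod_cast hL
  obtain ⟨θ, δ, hθ0, hθ, hδ0, hδq, hδθ, hδM, hδ1⟩ :=
    exists_rpow_profile hq.1 hM hε₂0.le hx zero_le_one hG0
  simp only [Real.rpow_zero, mul_one] at hδθ
  have hδG : ∀ i, δ i ≤ ε₂ / G := fun i => (hδθ i).trans hθ
  set H := G * ε₁ / (480 * L ^ 3 * ε₂ ^ 2) with hH
  have hH0 : 0 < H := by positivity
  have key := lt_of_distinguishes_of_tolerance T hq hR hε₁ hε hε₂ hL hn hδ0 hδq hδM hδ1 hH0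
    (fun i => by
      have h1 : H * (δ i * (480 * L ^ 3 * (ε₂ / ε₁))) ≤ 1 := by
        calc _ ≤ H * (ε₂ / G * (480 * L ^ 3 * (ε₂ / ε₁))) := by gcongr; exact hδG i
          _ = 1 := by rw [hH]; field_simp
      have h2 : 0 ≤ H * (δ i * (480 * L ^ 3 * (ε₂ / ε₁))) := by have := hδ0 i; positivity
      have h3 : H * (δ i * (480 * L ^ 3 * (ε₂ / ε₁))) ^ 2 ≤ 1 / H := by
        rw [le_div_iff₀ hH0]
        calc _ = (H * (δ i * (480 * L ^ 3 * (ε₂ / ε₁)))) ^ 2 := by ring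
          _ ≤ 1 := pow_le_one₀ h2 h1
      linarith [hq.1 i])
    (by
      have h1 : ∑ i, δ i ^ 2 ≤ ε₂ / G * ε₂ := by
        rw [← hδ1, mul_sum]
        refine sum_le_sum fun i _ => ?_
        rw [sq, hδ1]
        exact mul_le_mul_of_nonneg_right (hδG i) (hδ0 i)
      calc H * (L * ∑ i, δ i ^ 2) ≤ H * (L * (ε₂ / G * ε₂)) := by gcongr
        _ = ε₁ / (480 * L ^ 2) := by rw [hH]; field_simp
        _ ≤ ε₁ / 480 := by
          gcongr
          nlinarith
        _ ≤ 1 / 400 := by linarith) hT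
  have h1 : H / 400 * (192000 * L ^ 3) = G * (ε₁ / ε₂ ^ 2) := by rw [hH]; field_simp; norm_num
  have h2 := mul_le_mul_of_nonneg_right key.le (show (0 : ℝ) ≤ 192000 * L ^ 3 by positivity)
  rw [h1] at h2
  linarith

/-- The profile `r = 1/2`: as `δ² ≤ (ε₂ / G)² q`, the summand `q i` alone absorbs the perturbation,
and `H` comes out quadratic in `G ε₁ / ε₂ ^ 2`. -/
lemma sum_sqrt_kept_bound (hq : q ∈ stdSimplex ℝ (Fin n)) (hR : 1 / 2 ≤ ∑ j ∈ Mᶜ, q j)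
    (hM : ∀ i ∈ M, ∑ j ∈ upTo q i, q j ≤ 2 * ∑ j ∈ upTo q i with j ∈ M, q j)
    (hε₁ : 0 ≤ ε₁) (hε : ε₁ < ε₂) (hε₂ : ε₂ < 1 / 100) (hx : 2 * ε₂ ≤ x) {L : ℕ} (hL : 1 ≤ L)
    (hn : (n : ℝ) ≤ 10 ^ L) (hT : T.Distinguishes q ε₁ ε₂ (1 / 5) m) :
    ((∑ i ∈ M with removeSmallest q x i ≠ 0, q i ^ (1 / 2 : ℝ)) * (ε₁ / ε₂ ^ 2)) ^ 2 ≤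
      92160000 * L ^ 6 * m := by
  set G := ∑ i ∈ M with removeSmallest q x i ≠ 0, q i ^ (1 / 2 : ℝ) with hG
  have hG0 : 0 ≤ G := sum_nonneg fun i _ => Real.rpow_nonneg (hq.1 i) _
  have hε₂0 : 0 < ε₂ := hε₁.trans_lt hε
  rcases hε₁.eq_or_lt with rfl | hε₁
  · rw [zero_div, mul_zero, zero_pow two_ne_zero]; positivity
  rcases hG0.eq_or_lt with h0 | hG0
  · rw [← h0, zero_mul, zero_pow two_ne_zero]; positivity
  have hL1 : (1 : ℝ) ≤ L := by exact_mod_cast hL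
  obtain ⟨θ, δ, hθ0, hθ, hδ0, hδq, hδθ, hδM, hδ1⟩ :=
    exists_rpow_profile hq.1 hM hε₂0.le hx (by norm_num) hG0
  have hδG : ∀ i, δ i ^ 2 ≤ (ε₂ / G) ^ 2 * q i := fun i => by
    have h1 : (q i ^ (1 / 2 : ℝ)) ^ 2 = q i := by
      rw [← Real.rpow_natCast, ← Real.rpow_mul (hq.1 i)]; norm_num
    have h2 := Real.rpow_nonneg (hq.1 i) (1 / 2 : ℝ)
    calc δ i ^ 2 ≤ (ε₂ / G * q i ^ (1 / 2 : ℝ)) ^ 2 :=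
          pow_le_pow_left₀ (hδ0 i) ((hδθ i).trans (mul_le_mul_of_nonneg_right hθ h2)) 2
      _ = _ := by rw [mul_pow, h1]
  set H := (G * ε₁ / (480 * L ^ 3 * ε₂ ^ 2)) ^ 2 with hH
  have hH0 : 0 < H := by positivity
  have key := lt_of_distinguishes_of_tolerance T hq hR hε₁ hε hε₂ hL hn hδ0 hδq hδM hδ1 hH0
    (fun i => by
      have h1 : 0 < 1 / H := by positivity
      calc H * (δ i * (480 * L ^ 3 * (ε₂ / ε₁))) ^ 2
          = δ i ^ 2 * (H * (480 * L ^ 3 * (ε₂ / ε₁)) ^ 2) := by ring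
        _ ≤ (ε₂ / G) ^ 2 * q i * (H * (480 * L ^ 3 * (ε₂ / ε₁)) ^ 2) := by
          gcongr; exact hδG i
        _ = q i := by rw [hH]; field_simp
        _ ≤ _ := by linarith)
    (by
      have h1 : ∑ i, δ i ^ 2 ≤ (ε₂ / G) ^ 2 := by
        refine (sum_le_sum fun i _ => hδG i).trans_eq ?_
        rw [← mul_sum, hq.2, mul_one]
      have h2 : ε₁ / ε₂ ≤ 1 := (div_le_one hε₂0).2 hε.le
      calc H * (L * ∑ i, δ i ^ 2) ≤ H * (L * (ε₂ / G) ^ 2) := by gcongr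
        _ = (ε₁ / ε₂) ^ 2 / (480 ^ 2 * L ^ 5) := by rw [hH]; field_simp
        _ ≤ 1 / (480 ^ 2 * 1) := by
          gcongr
          · exact pow_le_one₀ (by positivity) h2
          · exact one_le_pow₀ hL1
        _ ≤ 1 / 400 := by norm_num) hT
  have h1 : H / 400 * (92160000 * L ^ 6) = (G * (ε₁ / ε₂ ^ 2)) ^ 2 := by
    rw [hH]; field_simp; norm_num
  have h2 := mul_le_mul_of_nonneg_right key.le (show (0 : ℝ) ≤ 92160000 * L ^ 6 by positivity)
  rw [h1] at h2
  linarith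

/-- The exponent `2/3` gives `δ³ ≤ θ³ q²`, so that `δ⁴ / q² ≤ θ³ δ` sums to `θ³ ε₂`. The assumption
`1 ≤ G` gives `G³ ≤ G⁴`, which the bound on `∑ δ²` uses. -/
lemma sum_rpow_two_thirds_kept_bound (hq : q ∈ stdSimplex ℝ (Fin n))
    (hR : 1 / 2 ≤ ∑ j ∈ Mᶜ, q j)
    (hM : ∀ i ∈ M, ∑ j ∈ upTo q i, q j ≤ 2 * ∑ j ∈ upTo q i with j ∈ M, q j)
    (hε₁ : 0 ≤ ε₁) (hε₂0 : 0 < ε₂) (hε₂ : ε₂ ≤ 1 / 2) (hx : 2 * ε₂ ≤ x)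
    (hG1 : 1 ≤ ∑ i ∈ M with removeSmallest q x i ≠ 0, q i ^ (2 / 3 : ℝ))
    (hT : T.Distinguishes q ε₁ ε₂ (1 / 5) m) :
    (∑ i ∈ M with removeSmallest q x i ≠ 0, q i ^ (2 / 3 : ℝ)) ^ 3 ≤
      (10000 * (m * ε₂ ^ 2)) ^ 2 := by
  set G := ∑ i ∈ M with removeSmallest q x i ≠ 0, q i ^ (2 / 3 : ℝ) with hG
  by_contra hcon
  push Not at hcon
  have hG0 : 0 < G := by linarith
  have hm : (0 : ℝ) ≤ m := m.2
  obtain ⟨θ, δ, hθ0, hθ, hδ0, hδq, hδθ, hδM, hδ1⟩ :=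
    exists_rpow_profile hq.1 hM hε₂0.le hx (by norm_num) hG0
  have hq1 : ∀ i, q i ≤ 1 := fun i => by
    rw [← hq.2]; exact single_le_sum (fun j _ => hq.1 j) (mem_univ i)
  refine not_distinguishes_of_identity T hq hR hε₁ hε₂ hδ0 hδq hδM hδ1 ?_ ?_ hT
  · have h1 : ∀ i, (m * (δ i ^ 2 / q i)) ^ 2 ≤ m ^ 2 * (θ ^ 3 * δ i) := by
      intro i
      rcases (hq.1 i).eq_or_lt with h0 | h0
      · have : δ i = 0 := le_antisymm (h0 ▸ hδq i) (hδ0 i)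
        simp [this]
      · rw [mul_pow, div_pow]
        refine mul_le_mul_of_nonneg_left ?_ (sq_nonneg _)
        rw [div_le_iff₀ (by positivity)]
        have h2 : (q i ^ (2 / 3 : ℝ)) ^ 3 = q i ^ 2 := by
          rw [← Real.rpow_natCast, ← Real.rpow_mul h0.le, ← Real.rpow_natCast]; norm_num
        have h3 : δ i ^ 3 ≤ θ ^ 3 * q i ^ 2 := by
          rw [← h2, ← mul_pow]
          exact pow_le_pow_left₀ (hδ0 i) (hδθ i) 3
        nlinarith [mul_le_mul_of_nonneg_left h3 (hδ0 i)]
    refine (sum_le_sum fun i _ => h1 i).trans ?_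
    rw [← mul_sum, ← mul_sum, hδ1]
    calc (m : ℝ) ^ 2 * (θ ^ 3 * ε₂) ≤ m ^ 2 * ((ε₂ / G) ^ 3 * ε₂) := by gcongr
      _ = (10000 * (m * ε₂ ^ 2)) ^ 2 / G ^ 3 / 10 ^ 8 := by field_simp; norm_num
      _ ≤ 1 / 10 ^ 8 := by
        gcongr
        exact (div_le_one (by positivity)).2 hcon.le
      _ ≤ 1 / 50 := by norm_num
  · have h1 : ∑ i, δ i ^ 2 ≤ θ ^ 2 := by
      calc ∑ i, δ i ^ 2 ≤ ∑ i, θ ^ 2 * q i := sum_le_sum fun i _ => by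
            calc δ i ^ 2 ≤ (θ * q i ^ (2 / 3 : ℝ)) ^ 2 := pow_le_pow_left₀ (hδ0 i) (hδθ i) 2
              _ = θ ^ 2 * q i ^ (4 / 3 : ℝ) := by
                rw [mul_pow, ← Real.rpow_natCast (q i ^ _), ← Real.rpow_mul (hq.1 i)]; norm_num
              _ ≤ θ ^ 2 * q i := by
                gcongr
                rcases (hq.1 i).eq_or_lt with h0 | h0
                · rw [← h0]; simp
                · exact (Real.rpow_le_rpow_of_exponent_ge h0 (hq1 i)
                    (by norm_num)).trans_eq (Real.rpow_one _)
        _ = θ ^ 2 := by rw [← mul_sum, hq.2, mul_one]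
    have h2 : (m : ℝ) * ∑ i, δ i ^ 2 ≤ m * (ε₂ / G) ^ 2 := by
      refine mul_le_mul_of_nonneg_left (h1.trans ?_) hm
      gcongr
    refine h2.trans (le_of_sq_le_sq ?_ (by norm_num))
    calc ((m : ℝ) * (ε₂ / G) ^ 2) ^ 2 = (10000 * (m * ε₂ ^ 2)) ^ 2 / G ^ 4 / 10000 ^ 2 := by
          field_simp
      _ ≤ 1 / 10000 ^ 2 := by
        gcongr
        rw [div_le_one (by positivity)]
        exact hcon.le.trans (pow_le_pow_right₀ hG1 (by norm_num))
      _ = (1 / 10000) ^ 2 := by norm_num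

end Bounds

/-! ### Assembling the bounds -/

lemma natCast_le_ten_pow (n : ℕ) : (n : ℝ) ≤ 10 ^ (⌈Real.log n⌉₊ + 1) := by
  rcases Nat.eq_zero_or_pos n with rfl | hn
  · simp
  have hn' : (0 : ℝ) < n := by exact_mod_cast hn
  have h1 : Real.log n ≤ (⌈Real.log n⌉₊ + 1 : ℕ) := by
    push_cast; linarith [Nat.le_ceil (Real.log n)]
  calc (n : ℝ) = Real.exp (Real.log n) := (Real.exp_log hn').symm
    _ ≤ Real.exp ((⌈Real.log n⌉₊ + 1 : ℕ) * 1) := by rw [mul_one]; exact Real.exp_le_exp.2 h1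
    _ = Real.exp 1 ^ (⌈Real.log n⌉₊ + 1) := Real.exp_nat_mul _ _
    _ ≤ _ := by
      gcongr
      linarith [Real.exp_one_lt_d9]

/-- The instance cost is at most polylogarithmically larger than the sample size of a tester. -/
lemma instanceCost_le_of_distinguishes {n : ℕ} {q : Fin n → ℝ} (hq : q ∈ stdSimplex ℝ (Fin n))
    {ε₁ ε₂ x : ℝ} (hε₁ : 0 ≤ ε₁) (hε : ε₁ < ε₂) (hε₂ : ε₂ < 1 / 100) (hx : 2 * ε₂ ≤ x)
    {T : Tester n} {m : ℝ≥0} (hT : T.Distinguishes q ε₁ ε₂ (1 / 5) m) :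
    instanceCost (removeSmallest q x) ε₁ ε₂ ≤
      64 * 10 ^ 9 * (1 + Real.log n) ^ 6 * (m + 1 / ε₂ ^ 2) := by
  obtain ⟨M, hR, hM, hkept⟩ := exists_perturbed_set hq
  have hε₂0 : 0 < ε₂ := hε₁.trans_lt hε
  have hm : (0 : ℝ) ≤ m := m.2
  set L := ⌈Real.log n⌉₊ + 1 with hLdef
  have hL : 1 ≤ L := by omega
  have hL1 : (1 : ℝ) ≤ L := by exact_mod_cast hL
  have hn := natCast_le_ten_pow n
  have hlog : 0 ≤ Real.log n := Real.log_natCast_nonneg n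
  have hLlog : (L : ℝ) ≤ 2 * (1 + Real.log n) := by
    have := Nat.ceil_lt_add_one hlog
    rw [hLdef]; push_cast; linarith
  have hA := card_kept_bound hq hR hM hε₁ hε hε₂ hx hL hn hT
  have hB := sum_sqrt_kept_bound hq hR hM hε₁ hε hε₂ hx hL hn hT
  have hkA := sum_kept_rpow_le hq hkept x (le_refl (0 : ℝ))
  have hkB := sum_kept_rpow_le hq hkept x (show (0 : ℝ) ≤ 1 / 2 by norm_num)
  have hkC := sum_kept_rpow_le hq hkept x (show (0 : ℝ) ≤ 2 / 3 by norm_num)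
  set GA := ∑ i ∈ M with removeSmallest q x i ≠ 0, q i ^ (0 : ℝ)
  set GB := ∑ i ∈ M with removeSmallest q x i ≠ 0, q i ^ (1 / 2 : ℝ)
  set t := ε₁ / ε₂ ^ 2 with ht
  have ht0 : 0 ≤ t := by positivity
  have ht1 : t ≤ 1 / ε₂ ^ 2 := by rw [ht]; gcongr; linarith
  have ht2 : t ^ 2 ≤ 1 / ε₂ ^ 2 := by
    rw [ht, div_pow, div_le_div_iff₀ (by positivity) (by positivity)]
    have : ε₁ ^ 2 ≤ ε₂ ^ 2 := pow_le_pow_left₀ hε₁ hε.le 2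
    nlinarith [sq_nonneg ε₂]
  have h1 : l0Norm (removeSmallest q x) * t ≤ 1 / ε₂ ^ 2 + 384000 * L ^ 6 * m := by
    have h2 : l0Norm (removeSmallest q x) ≤ 1 + 2 * GA := by
      simpa [l0Norm] using hkA
    have h3 : (L : ℝ) ^ 3 ≤ L ^ 6 := pow_le_pow_right₀ hL1 (by norm_num)
    have h4 := mul_le_mul_of_nonneg_right h3 hm
    have h5 := mul_le_mul_of_nonneg_right h2 ht0
    linarith
  have h2 : lrNorm (1 / 2) (removeSmallest q x) * t ^ 2 ≤
      2 * (1 / ε₂ ^ 2) + 737280000 * L ^ 6 * m := by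
    have hS0 : 0 ≤ ∑ i with removeSmallest q x i ≠ 0, q i ^ (1 / 2 : ℝ) :=
      sum_nonneg fun i _ => Real.rpow_nonneg (hq.1 i) _
    have h3 : lrNorm (1 / 2) (removeSmallest q x) ≤ 2 + 8 * GB ^ 2 := by
      rw [lrNorm, sum_removeSmallest_rpow hq.1 x (by norm_num)]
      have : ((1 : ℝ) / (1 / 2)) = (2 : ℕ) := by norm_num
      rw [this, Real.rpow_natCast]
      refine (pow_le_pow_left₀ hS0 hkB 2).trans ?_
      nlinarith [sq_nonneg (1 - 2 * GB)]
    have h4 := mul_le_mul_of_nonneg_right h3 (sq_nonneg t)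
    linarith
  have h3 : lrNorm (2 / 3) (removeSmallest q x) / ε₂ ^ 2 ≤ 6 * (1 / ε₂ ^ 2) + 60000 * m := by
    rw [lrNorm, sum_removeSmallest_rpow hq.1 x (by norm_num)]
    set S := ∑ i with removeSmallest q x i ≠ 0, q i ^ (2 / 3 : ℝ)
    have hS0 : 0 ≤ S := sum_nonneg fun i _ => Real.rpow_nonneg (hq.1 i) _
    have hsq : (S ^ ((1 : ℝ) / (2 / 3))) ^ 2 = S ^ 3 := by
      rw [← Real.rpow_natCast, ← Real.rpow_mul hS0, ← Real.rpow_natCast]; norm_num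
    rw [div_le_iff₀ (by positivity)]
    have hr : (6 * (1 / ε₂ ^ 2) + 60000 * (m : ℝ)) * ε₂ ^ 2 = 6 + 60000 * (m * ε₂ ^ 2) := by
      field_simp
    have hmε : 0 ≤ (m : ℝ) * ε₂ ^ 2 := by positivity
    rw [hr]
    refine le_of_sq_le_sq ?_ (by positivity)
    rw [hsq]
    -- If the sum over `M` is at most `1`, then `S ≤ 3` and `S³ ≤ 27 ≤ 6²`: the additive term
    -- suffices.
    rcases le_total (∑ i ∈ M with removeSmallest q x i ≠ 0, q i ^ (2 / 3 : ℝ)) 1 with hG | hG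
    · have : S ^ 3 ≤ 3 ^ 3 := pow_le_pow_left₀ hS0 (by linarith) 3
      nlinarith
    · have hC := sum_rpow_two_thirds_kept_bound hq hR hM hε₁ hε₂0 (by linarith) hx hG hT
      have : S ^ 3 ≤ (3 * ∑ i ∈ M with removeSmallest q x i ≠ 0, q i ^ (2 / 3 : ℝ)) ^ 3 :=
        pow_le_pow_left₀ hS0 (by linarith) 3
      rw [mul_pow] at this
      have h5 : (60000 * (m * ε₂ ^ 2)) ^ 2 ≤ (6 + 60000 * (m * ε₂ ^ 2)) ^ 2 :=
        pow_le_pow_left₀ (by positivity) (by linarith) 2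
      have h6 := sq_nonneg ((m : ℝ) * ε₂ ^ 2)
      linarith
  have hL6 : (L : ℝ) ^ 6 ≤ 64 * (1 + Real.log n) ^ 6 :=
    (pow_le_pow_left₀ (by positivity) hLlog 6).trans_eq (by ring)
  have hΛ : 1 ≤ (1 + Real.log n) ^ 6 := one_le_pow₀ (by linarith)
  unfold instanceCost
  have h4 := mul_le_mul_of_nonneg_right hL6 hm
  have h5 := mul_le_mul_of_nonneg_right hΛ hm
  have h6 := mul_le_mul_of_nonneg_right hΛ (show 0 ≤ 1 / ε₂ ^ 2 by positivity)
  linarith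

end TolerantTesting

end

theorem theoremC :
    ∃ c : ℝ, 0 < c ∧ ∃ A : ℝ, 0 < A ∧ ∃ C : ℝ, 0 < C ∧ ∃ k : ℕ,
      ∀ (n : ℕ) (q : Fin n → ℝ), q ∈ stdSimplex ℝ (Fin n) →
        ∀ ε₁ ε₂ : ℝ, 0 ≤ ε₁ → ε₁ < ε₂ → ε₂ < c / 4 →
          ∀ F : ℝ, F = TolerantTesting.instanceCost
              (TolerantTesting.removeSmallest q (4 * ε₂ / c)) ε₁ ε₂ →
            ENNReal.ofReal
                (A * F / ((1 + Real.log n) * (1 + Real.log (1 + F))) ^ k - C / ε₂ ^ 2)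
              ≤ TolerantTesting.sampleComplexity q ε₁ ε₂ (1 / 5) := by
  -- `c = 1/25` gives `ε₂ < 1/100` and removed mass up to `100 ε₂`, far above the `2 ε₂` needed. The
  -- exponent `6` comes from `L ^ 6`; the factor `1 + log (1 + F)` only has to be at least `1`.
  refine ⟨1 / 25, by norm_num, 1 / (64 * 10 ^ 9), by norm_num, 1, one_pos, 6, ?_⟩
  intro n q hq ε₁ ε₂ hε₁ hε hε₂ F hF
  have hε₂0 : 0 < ε₂ := hε₁.trans_lt hε
  have hF0 : 0 ≤ F := by
    rw [hF]
    unfold TolerantTesting.instanceCost TolerantTesting.l0Norm TolerantTesting.lrNorm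
    positivity
  refine le_iInf₂ fun m ⟨T, hT⟩ => ENNReal.ofReal_le_of_le_toReal ?_
  rw [ENNReal.coe_toReal, sub_le_iff_le_add]
  have hcost := TolerantTesting.instanceCost_le_of_distinguishes hq hε₁ hε (by linarith)
    (show 2 * ε₂ ≤ 4 * ε₂ / (1 / 25) by linarith) hT
  rw [← hF] at hcost
  have hlogn : 0 ≤ Real.log n := Real.log_natCast_nonneg n
  have hlogF : 0 ≤ Real.log (1 + F) := Real.log_nonneg (by linarith)
  have hle : (1 + Real.log n) ^ 6 ≤ ((1 + Real.log n) * (1 + Real.log (1 + F))) ^ 6 := by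
    gcongr
    exact le_mul_of_one_le_right (by linarith) (by linarith)
  have hpos : 0 < (1 + Real.log n) ^ 6 := by positivity
  rw [div_le_iff₀ (hpos.trans_le hle)]
  have hfin : 1 / (64 * 10 ^ 9) * F ≤ ((m : ℝ) + 1 / ε₂ ^ 2) * (1 + Real.log n) ^ 6 := by
    linarith
  exact hfin.trans (mul_le_mul_of_nonneg_left hle (by positivity))
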